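/- Let $N\ge 1$ and let $A=(A_{ij})$ be a real symmetric positive-definite $N\times N$ matrix. On $\mathcal B=\mathbb R^N\times\mathbb C$, with points $\vec\mu=(\mu_1,\dots,\mu_N,\eta)$, put $$|\vec\mu|_A=\sqrt{\textstyle\sum_{i,j}A_{ij}\mu_i\mu_j+\det A\,|\eta|^2},\qquad \mathrm d\mathrm{Vol}_A=(\det A)^{3/2}\,\mathrm d\mu_1\cdots \mathrm d\mu_N\,\mathrm d\mathrm{Re}\,\eta\,\mathrm d\mathrm{Im}\,\eta,$$ $$\Delta_A=\sum_{i,j}A^{-1}_{ij}\frac{\partial^2}{\partial\mu_i\partial\mu_j}+4(\det A)^{-1}\frac{\partial^2}{\partial\eta\,\partial\bar\eta}.$$ Let $\pi:\mathbb C^{N+1}\to\mathcal B$, $\pi(z)=\bigl(\tfrac12(|z_1|^2-|z_0|^2),\dots,\tfrac12(|z_N|^2-|z_0|^2),\,z_0z_1\cdots z_N\bigr)$. For $I\subseteq\{0,\dots,N\}$ with $|I|\ge2$ let $\mathfrak D_I=\pi(\{z_i=0\ \forall i\in I,\ z_j\ne0\ \forall j\notin I\})$, and let $\mathfrak D=\bigcup_{|I|\ge2}\mathfrak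 D_I$ be the discriminant locus. Let $\alpha(n)$ be the volume of the unit ball in $\mathbb R^n$ and $c_A=\dfrac{2\pi\sqrt{\det A}}{N(N+2)\,\alpha(N+2)}$. For $1\le i\le N$ let $\vec t^{(i)}\in\mathcal B$ have $\eta=0$, $i$-th coordinate $0$ and $k$-th coordinate $t_k$ for $k\ne i$. For $1\le i<j\le N$ let $\vec t^{(ij)}$ have $\eta=0$, $i$-th and $j$-th coordinates $0$ and the other coordinates $t_k$. Let $\vec{\mathbf 1}=(1,\dots,1,0)$. Define $$\alpha_{0i}(\vec\mu)=c_A\int_{\mathbb R_+^{N-1}}\frac{\prod_{k\ne i}\mathrm dt_k}{|\vec\mu-\vec t^{(i)}|_A^{N}},\qquad \alpha_{ij}(\vec\mu)=c_A\int_{\mathbb R_+^{N-1}}\frac{\mathrm ds\,\prod_{k\ne i,j}\mathrm dt_k}{|\vec\mu-\vec t^{(ij)}+s\vec{\mathbf 1}|_A^{N}}\quad(i<j),$$ and set $\alpha_{ji}=\alpha_{ij}$, $\alpha_{ii}=0$. For test functions $f\in C_c^\infty(\mathcal B)$ let $$\mathcal H^{N-1}|_{\mathfrak D_{0i}}(f)=\int_{\mathbb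 R_+^{N-1}}f(\vec t^{(i)})\prod_{k\ne i}\mathrm dt_k,\qquad \mathcal H^{N-1}|_{\mathfrak D_{ij}}(f)=\int_{\mathbb R_+^{N-1}}f(\vec t^{(ij)}-s\vec{\mathbf 1})\,\mathrm ds\prod_{k\ne i,j}\mathrm dt_k ,$$ and define the $3$-currents $$\mathfrak D_{0i}=-\mathcal H^{N-1}|_{\mathfrak D_{0i}}\,\mathrm d\mu_i\wedge \mathrm d\mathrm{Re}\,\eta\wedge \mathrm d\mathrm{Im}\,\eta,\qquad \mathfrak D_{ij}=-\mathcal H^{N-1}|_{\mathfrak D_{ij}}\,(\mathrm d\mu_j-\mathrm d\mu_i)\wedge \mathrm d\mathrm{Re}\,\eta\wedge \mathrm d\mathrm{Im}\,\eta .$$ Then the following hold. 1. The integrals converge on $\mathcal B\setminus\mathfrak D$. The functions $\alpha_{0i},\alpha_{ij}$ are smooth on $\mathcal B\setminus\mathfrak D$ and locally integrable on $\mathcal B$. In the sense of distributions on $\mathcal B$, $$\Delta_A\alpha_{0i}\,\mathrm d\mathrm{Vol}_A=-2\pi\sqrt{\det A}\;\mathcal H^{N-1}|_{\mathfrak D_{0i}},\qquad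 \Delta_A\alpha_{ij}\,\mathrm d\mathrm{Vol}_A=-2\pi\sqrt{\det A}\;\mathcal H^{N-1}|_{\mathfrak D_{ij}}\quad(i<j).$$ 2. Both pointwise on $\mathcal B\setminus\mathfrak D$ and in the sense of distributions on $\mathcal B$, $$\frac{\partial\alpha_{ij}}{\partial\mu_k}=\frac{\partial\alpha_{ik}}{\partial\mu_j}\ \text{ for distinct } i,j,k\in\{1,\dots,N\},$$ $$\frac{\partial\alpha_{0i}}{\partial\mu_j}=\frac{\partial\alpha_{0j}}{\partial\mu_i}=-\sum_{t=1}^N\frac{\partial\alpha_{ij}}{\partial\mu_t}\ \text{ for distinct } i,j\in\{1,\dots,N\}.$$ 3. Put $v_{ii}=\alpha_{0i}+\sum_{k\ne i}\alpha_{ik}$, $v_{ij}=-\alpha_{ij}$ for $i\neq j$, and $w=\det A\sum_{i,j}A^{-1}_{ij}v_{ij}$. These functions are smooth on $\mathcal B\setminus\mathfrak D$ and locally integrable on $\mathcal B$. On $\mathcal B\setminus\mathfrak D$ they satisfy, for all $i,j,k\in\{1,\dots,N\}$, the integrability conditions $$\frac{\partial v_{ij}}{\partial\mu_k}=\frac{\partial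 v_{ik}}{\partial\mu_j},\qquad \frac{\partial^2w}{\partial\mu_i\partial\mu_j}=-4\frac{\partial^2v_{ij}}{\partial\eta\,\partial\bar\eta},$$ and the harmonicity conditions $$\Delta_Av_{ij}=0,\qquad \Delta_Aw=0,\qquad \det A\sum_{k,l}A^{-1}_{kl}v_{kl}=w.$$ On all of $\mathcal B$ they satisfy the linearized Chern-class equation, an identity of $3$-currents with values in $\mathbb C^N=\bigoplus_j\mathbb C e_j$: $$\frac{\sqrt{-1}}{4\pi}\sum_{i,j=1}^N\Bigl(\frac{\partial^2w}{\partial\mu_i\partial\mu_j}+4\frac{\partial^2v_{ij}}{\partial\eta\,\partial\bar\eta}\Bigr)\mathrm d\mu_i\wedge \mathrm d\eta\wedge \mathrm d\bar\eta\otimes e_j=\sum_{i=1}^N\mathfrak D_{0i}\otimes e_i+\sum_{1\le i<j\le N}\mathfrak D_{ij}\otimes(e_j-e_i).$$ -/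

import Mathlib

open MeasureTheory
open scoped ContDiff

noncomputable section

namespace TaubNUT

/-! The index `i : Fin N` stands for the index `i + 1 ∈ {1, …, N}` of the moment coordinates;
the index set `{0, 1, …, N}` is `Fin (N + 1)`, so `i : Fin N` is `i.succ : Fin (N + 1)` there. -/

/-- The base `ℝ^N × ℂ`, with points `(μ, η)`. Its `volume` is Lebesgue measure
`dμ₁ ⋯ dμ_N dRe η dIm η`. -/
abbrev Base (N : ℕ) : Type := (Fin N → ℝ) × ℂ

variable {N : ℕ}

/-! ### The discriminant locus -/

/-- The singular torus bundle `π : ℂ^{N+1} → ℝ^N × ℂ`. -/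
def bundleMap (z : Fin (N + 1) → ℂ) : Base N :=
  (fun i => (1 / 2) * (‖z i.succ‖ ^ 2 - ‖z 0‖ ^ 2), ∏ i, z i)

/-- The stratum `D_I`. -/
def stratum (I : Finset (Fin (N + 1))) : Set (Base N) :=
  bundleMap '' {z | (∀ i ∈ I, z i = 0) ∧ ∀ j ∉ I, z j ≠ 0}

/-- The discriminant locus `D = ⋃_{|I| ≥ 2} D_I`. -/
def discriminant (N : ℕ) : Set (Base N) :=
  ⋃ (I : Finset (Fin (N + 1))) (_ : 2 ≤ I.card), stratum I

/-! ### Differential operators -/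

/-- `∂f/∂μ_k`. -/
def dMu (k : Fin N) (f : Base N → ℝ) (p : Base N) : ℝ := fderiv ℝ f p (Pi.single k 1, 0)

/-- `∂f/∂(Re η)`. -/
def dReEta (f : Base N → ℝ) (p : Base N) : ℝ := fderiv ℝ f p (0, 1)

/-- `∂f/∂(Im η)`. -/
def dImEta (f : Base N → ℝ) (p : Base N) : ℝ := fderiv ℝ f p (0, Complex.I)

/-- `∂²f/∂η∂η̄ = ¼ (∂²f/∂(Re η)² + ∂²f/∂(Im η)²)`. -/
def dEtaEtaBar (f : Base N → ℝ) (p : Base N) : ℝ :=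
  (1 / 4) * (dReEta (dReEta f) p + dImEta (dImEta f) p)

/-- The Laplacian `Δ_A` of the flat metric `g_A = A_ij dμ_i dμ_j + det A |dη|²`. -/
def laplacian (A : Matrix (Fin N) (Fin N) ℝ) (f : Base N → ℝ) (p : Base N) : ℝ :=
  (∑ i, ∑ j, A⁻¹ i j * dMu i (dMu j f) p) + 4 * (A.det)⁻¹ * dEtaEtaBar f p

/-- The density of `dVol_A` with respect to Lebesgue measure: `(det A)^{3/2}`. -/
def volDensity (A : Matrix (Fin N) (Fin N) ℝ) : ℝ := A.det ^ (3 / 2 : ℝ)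

/-- Test functions on `ℝ^N × ℂ`. -/
def IsTestFunction (f : Base N → ℝ) : Prop := ContDiff ℝ ∞ f ∧ HasCompactSupport f

/-! ### The explicit integrals -/

/-- `|(μ, η)|_A = √(A_ij μ_i μ_j + det A |η|²)`. -/
def normA (A : Matrix (Fin N) (Fin N) ℝ) (p : Base N) : ℝ :=
  √((∑ i, ∑ j, A i j * p.1 i * p.1 j) + A.det * ‖p.2‖ ^ 2)

/-- The volume of the unit ball in `ℝ^n`. -/
def unitBallVolume (n : ℕ) : ℝ :=
  (volume (Metric.ball (0 : EuclideanSpace ℝ (Fin n)) 1)).toReal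

/-- `2π √(det A) / (N (N + 2) α(N + 2))`. -/
def kernelConst (A : Matrix (Fin N) (Fin N) ℝ) : ℝ :=
  2 * Real.pi * √A.det / ((N : ℝ) * ((N : ℝ) + 2) * unitBallVolume (N + 2))

/-- The parameters `(t_1, …, t̂_i, …, t_N)`. -/
abbrev Param0 (i : Fin N) : Type := {k : Fin N // k ≠ i} → ℝ

/-- The parameters `(s; t_1, …, t̂_i, …, t̂_j, …, t_N)`. -/
abbrev Param (i j : Fin N) : Type := ℝ × ({k : Fin N // k ≠ i ∧ k ≠ j} → ℝ)

/-- The open orthant `ℝ_+^{N-1}` of parameters `t`. -/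
def orthant0 (i : Fin N) : Set (Param0 i) := {t | ∀ k, 0 < t k}

/-- The open orthant `ℝ_+^{N-1}` of parameters `(s; t)`. -/
def orthant (i j : Fin N) : Set (Param i j) := {q | 0 < q.1 ∧ ∀ k, 0 < q.2 k}

/-- `t^{(i)}`: the parameters `t` with `0` inserted at the place `i`, and `η = 0`. -/
def tVec0 (i : Fin N) (t : Param0 i) : Base N :=
  (fun k => if h : k ≠ i then t ⟨k, h⟩ else 0, 0)

/-- `t^{(ij)}`: the parameters `t` with `0` inserted at the places `i` and `j`, and `η = 0`. -/
def tVec (i j : Fin N) (q : Param i j) : Base N :=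
  (fun k => if h : k ≠ i ∧ k ≠ j then q.2 ⟨k, h⟩ else 0, 0)

/-- The vector `(1, …, 1, 0)`. -/
def oneVec (N : ℕ) : Base N := (fun _ => 1, 0)

/-- The integrand `|μ - t^{(i)}|_A^{-N}`. -/
def kernel0 (A : Matrix (Fin N) (Fin N) ℝ) (i : Fin N) (p : Base N) (t : Param0 i) : ℝ :=
  1 / normA A (p - tVec0 i t) ^ N

/-- The integrand `|μ - t^{(ij)} + s 1|_A^{-N}`. -/
def kernel (A : Matrix (Fin N) (Fin N) ℝ) (i j : Fin N) (p : Base N) (q : Param i j) : ℝ :=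
  1 / normA A (p - tVec i j q + q.1 • oneVec N) ^ N

/-- `α_{0i}`. -/
def alpha0 (A : Matrix (Fin N) (Fin N) ℝ) (i : Fin N) (p : Base N) : ℝ :=
  kernelConst A * ∫ t in orthant0 i, kernel0 A i p t

/-- The integral that defines `α_{ij}` for `1 ≤ i < j ≤ N`. -/
def alphaIntegral (A : Matrix (Fin N) (Fin N) ℝ) (i j : Fin N) (p : Base N) : ℝ :=
  kernelConst A * ∫ q in orthant i j, kernel A i j p q

/-- `α_{ij}` for all `1 ≤ i, j ≤ N`, with `α_{ij} = α_{ji}` and `α_{ii} = 0`. -/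
def alpha (A : Matrix (Fin N) (Fin N) ℝ) (i j : Fin N) (p : Base N) : ℝ :=
  if i < j then alphaIntegral A i j p else if j < i then alphaIntegral A j i p else 0

/-- The measure `H^{N-1}|_{D_{0i}}` as a functional. -/
def measure0 (i : Fin N) (f : Base N → ℝ) : ℝ := ∫ t in orthant0 i, f (tVec0 i t)

/-- The measure `H^{N-1}|_{D_{ij}}` as a functional; `(s, t) ↦ t^{(ij)} - s 1` parametrizes
`D_{ij}` up to its boundary strata. -/
def measureD (i j : Fin N) (f : Base N → ℝ) : ℝ :=
  ∫ q in orthant i j, f (tVec i j q - q.1 • oneVec N)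

/-! ### Currents of degree three

A current of degree three on `ℝ^N × ℂ` with values in the complexified Lie algebra `𝔱^N ⊗ ℂ = ℂ^N`
is a distribution with values in `Λ³ (ℝ^N × ℂ)^* ⊗ ℂ^N`: it sends a test function `f` to an element
of `ThreeForms N`. The basis vector `e_j` of the Lie algebra is the `j`-th place. -/

/-- Constant-coefficient complex three-forms. -/
abbrev Form3 (N : ℕ) : Type := Base N [⋀^Fin 3]→ₗ[ℝ] ℂ

/-- Constant-coefficient complex three-forms with values in the Lie algebra. -/
abbrev ThreeForms (N : ℕ) : Type := Fin N → Form3 N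

/-- `a ⊗ e_j`. -/
def tensorE (a : Form3 N) (j : Fin N) : ThreeForms N := Pi.single j a

/-- The one-form `dμ_i`. -/
def formMu (i : Fin N) : Base N →ₗ[ℝ] ℂ where
  toFun p := (p.1 i : ℂ)
  map_add' _ _ := by simp
  map_smul' _ _ := by simp

/-- The one-form `dη`. -/
def formEta : Base N →ₗ[ℝ] ℂ where
  toFun p := p.2
  map_add' _ _ := by simp
  map_smul' _ _ := by simp

/-- The one-form `dη̄`. -/
def formEtaBar : Base N →ₗ[ℝ] ℂ where
  toFun p := (starRingEnd ℂ) p.2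
  map_add' _ _ := by simp
  map_smul' _ _ := by simp

/-- The one-form `dRe η`. -/
def formRe : Base N →ₗ[ℝ] ℂ where
  toFun p := (p.2.re : ℂ)
  map_add' _ _ := by simp
  map_smul' _ _ := by simp

/-- The one-form `dIm η`. -/
def formIm : Base N →ₗ[ℝ] ℂ where
  toFun p := (p.2.im : ℂ)
  map_add' _ _ := by simp
  map_smul' _ _ := by simp

/-- `a ∧ b ∧ c`, that is `(x₀, x₁, x₂) ↦ ∑_σ sign σ · a(x_{σ 0}) b(x_{σ 1}) c(x_{σ 2})`. -/
def wedge3 (a b c : Base N →ₗ[ℝ] ℂ) : Form3 N :=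
  MultilinearMap.alternatization
    ((MultilinearMap.mkPiAlgebra ℝ (Fin 3) ℂ).compLinearMap ![a, b, c])

/-- The current `D_{0i} = - H^{N-1}|_{D_{0i}} dμ_i ∧ dRe η ∧ dIm η`. -/
def current0 (i : Fin N) (f : Base N → ℝ) : Form3 N :=
  (-(measure0 i f : ℂ)) • wedge3 (formMu i) formRe formIm

/-- The current `D_{ij} = - H^{N-1}|_{D_{ij}} (dμ_j - dμ_i) ∧ dRe η ∧ dIm η`. -/
def currentD (i j : Fin N) (f : Base N → ℝ) : Form3 N :=
  (-(measureD i j f : ℂ)) • wedge3 (formMu j - formMu i) formRe formIm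

/-- The pairing of `∂²w/∂μ_i∂μ_j + 4 ∂²u/∂η∂η̄`, taken in the sense of distributions, with `f`. -/
def chernPairing (w u : Base N → ℝ) (i j : Fin N) (f : Base N → ℝ) : ℝ :=
  (∫ p, w p * dMu i (dMu j f) p) + 4 * ∫ p, u p * dEtaEtaBar f p

/-- The current
`√-1/(4π) ∑_{i,j} (∂²w/∂μ_i∂μ_j + 4 ∂²v_ij/∂η∂η̄) dμ_i ∧ dη ∧ dη̄ ⊗ e_j`. -/
def chernCurrent (v : Fin N → Fin N → Base N → ℝ) (w : Base N → ℝ) (f : Base N → ℝ) :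
    ThreeForms N :=
  (Complex.I / (4 * Real.pi)) • ∑ i, ∑ j,
    tensorE ((chernPairing w (v i j) i j f : ℂ) • wedge3 (formMu i) formEta formEtaBar) j

/-- The current `∑_i D_{0i} ⊗ e_i + ∑_{i<j} D_{ij} ⊗ (e_j - e_i)`. -/
def discriminantCurrent (f : Base N → ℝ) : ThreeForms N :=
  (∑ i, tensorE (current0 i f) i) +
    ∑ i, ∑ j, if i < j then tensorE (currentD i j f) j - tensorE (currentD i j f) i else 0

/-! ### The first-order ansatz and its equations -/

/-- `v_ii = α_{0i} + ∑_{k ≠ i} α_{ik}` and `v_ij = -α_{ij}` for `i ≠ j`. -/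
def ansatzV (A : Matrix (Fin N) (Fin N) ℝ) (i j : Fin N) (p : Base N) : ℝ :=
  if i = j then alpha0 A i p + ∑ k ∈ Finset.univ.filter (fun k => k ≠ i), alpha A i k p
  else -alpha A i j p

/-- `w = det A · A⁻¹_ij v_ij`. -/
def ansatzW (A : Matrix (Fin N) (Fin N) ℝ) (p : Base N) : ℝ :=
  A.det * ∑ i, ∑ j, A⁻¹ i j * ansatzV A i j p

/-- The integrability conditions on a set `S`. -/
def Integrability (v : Fin N → Fin N → Base N → ℝ) (w : Base N → ℝ) (S : Set (Base N)) : Prop :=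
  (∀ i j k, ∀ p ∈ S, dMu k (v i j) p = dMu j (v i k) p) ∧
  ∀ i j, ∀ p ∈ S, dMu i (dMu j w) p = -4 * dEtaEtaBar (v i j) p

/-- The linearized Calabi--Yau condition on a set `S`. -/
def Harmonicity (A : Matrix (Fin N) (Fin N) ℝ) (v : Fin N → Fin N → Base N → ℝ)
    (w : Base N → ℝ) (S : Set (Base N)) : Prop :=
  (∀ i j, ∀ p ∈ S, laplacian A (v i j) p = 0) ∧
  (∀ p ∈ S, laplacian A w p = 0) ∧
  ∀ p ∈ S, A.det * ∑ i, ∑ j, A⁻¹ i j * v i j p = w p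

/-- The linearized Chern-class condition, an identity of currents on all of `ℝ^N × ℂ`. -/
def ChernCondition (v : Fin N → Fin N → Base N → ℝ) (w : Base N → ℝ) : Prop :=
  (∀ i j, LocallyIntegrable (v i j)) ∧ LocallyIntegrable w ∧
  ∀ f, IsTestFunction f → chernCurrent v w f = discriminantCurrent f

/-- `Δ_A u dVol_A = m` in the sense of distributions, for a locally integrable function `u`. -/
def DistribLaplacianEq (A : Matrix (Fin N) (Fin N) ℝ) (u : Base N → ℝ)
    (m : (Base N → ℝ) → ℝ) : Prop :=
  LocallyIntegrable u ∧
  ∀ f, IsTestFunction f → ∫ p, u p * laplacian A f p * volDensity A = m f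

end TaubNUT

end

open TaubNUT

set_option linter.unusedSectionVars false

noncomputable section

/-! Put E_0 = -(1, …, 1) and let E_1, …, E_N be the standard basis, so that ∑ E_c = 0. The index 0
then plays the same role as the others: for 0 ≤ a ≠ b ≤ N the closure of D_{ab} is the cone of the
points ∑ u_k E_k with u ≥ 0 and u_a = u_b = 0, placed at η = 0. Up to a constant, |·|_A^{-N} is the
fundamental solution of Δ_A in dimension N + 2, so α_{ab} is a multiple of the Newton potential of
the measure du on this cone (`alpha0_eq`, `alpha_eq`).

Three facts about these potentials carry the theorem. Size: the cone has dimension N - 1 and the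
kernel decays with exponent N, so the integrals converge (`integrable_faceMeasure`) and can be
differentiated under the integral sign (`IsSource.contDiffAt`). Local integrability follows from
Fubini's theorem and the decay of Newton convolutions (`exists_integral_norm_le`). Poisson equation:
it is proved for the kernel by the regularization |p|_A² + ε²
(`integral_newtonKernel_mul_laplacian`) and then integrated over the cone. Commutation:
differentiation of α_{ab} along a third ray E_c integrates out that ray (`integral_fderiv_rayVec`)
and leaves the potential of the face u_a = u_b = u_c = 0, which is symmetric in a, b, c. In the weak
form the same argument is applied to the convolution of the test function with the kernel. Together
with ∑ E_c = 0 this gives `CommRelations`, once pointwise and once weakly.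

The rest is formal. The relations give ∂_k v_ij = ∂_j v_ik, hence ∂_i ∂_j v_kl = ∂_k ∂_l v_ij.
Contraction with A⁻¹ yields ∂_i ∂_j w + 4 ∂_η ∂_η̄ v_ij = det A · Δ_A v_ij, pointwise and weakly.
The right side vanishes off the discriminant locus. On the whole base it is a combination of the
face measures, and the Chern-class equation becomes a comparison of coefficients. -/

namespace TaubNUT

/-! ### Homogeneous kernels and their potentials -/

section HomKernel

variable {E F : Type} [NormedAddCommGroup E] [NormedSpace ℝ E] [NormedAddCommGroup F]
  [NormedSpace ℝ F]

/-- A function that is smooth away from the origin and positively homogeneous of degree `-d`. -/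
structure IsHomKernel (d : ℕ) (Φ : E → F) : Prop where
  smooth : ContDiffOn ℝ ∞ Φ {0}ᶜ
  homog : ∀ c : ℝ, 0 < c → ∀ x, x ≠ 0 → Φ (c • x) = (c ^ d)⁻¹ • Φ x

namespace IsHomKernel

variable {d : ℕ} {Φ : E → F}

lemma contDiffAt (h : IsHomKernel d Φ) {x : E} (hx : x ≠ 0) : ContDiffAt ℝ ∞ Φ x :=
  h.smooth.contDiffAt (isOpen_compl_singleton.mem_nhds hx)

lemma differentiableAt (h : IsHomKernel d Φ) {x : E} (hx : x ≠ 0) : DifferentiableAt ℝ Φ x :=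
  (h.contDiffAt hx).differentiableAt (by simp)

lemma fderiv (h : IsHomKernel d Φ) : IsHomKernel (d + 1) (fderiv ℝ Φ) where
  smooth := h.smooth.fderiv_of_isOpen isOpen_compl_singleton (by simp)
  homog c hc x hx := by
    have h1 : (fun y => Φ (c • y)) =ᶠ[nhds x] fun y => (c ^ d)⁻¹ • Φ y := by
      filter_upwards [isOpen_compl_singleton.mem_nhds hx] with y hy using h.homog c hc y hy
    have h2 := h1.fderiv_eq (𝕜 := ℝ)
    rw [fderiv_comp_smul, fderiv_fun_const_smul (h.differentiableAt hx)] at h2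
    have h3 : _root_.fderiv ℝ Φ (c • x) = c⁻¹ • c • _root_.fderiv ℝ Φ (c • x) := by
      rw [smul_smul, inv_mul_cancel₀ hc.ne', one_smul]
    rw [h3, h2, smul_smul, pow_succ, mul_inv, mul_comm]

lemma clm_apply {G : Type} [NormedAddCommGroup G] [NormedSpace ℝ G] {Ψ : E → G →L[ℝ] F}
    (h : IsHomKernel d Ψ) (v : G) : IsHomKernel d (fun x => Ψ x v) where
  smooth := h.smooth.clm_apply contDiffOn_const
  homog c hc x hx := by simp [h.homog c hc x hx]

/-- Homogeneity reduces the estimate to the unit sphere, where compactness applies. -/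
lemma exists_bound [FiniteDimensional ℝ E] (h : IsHomKernel d Φ) :
    ∃ C, 0 ≤ C ∧ ∀ x, x ≠ 0 → ‖Φ x‖ ≤ C * (‖x‖ ^ d)⁻¹ := by
  have hc : ContinuousOn Φ (Metric.sphere 0 1) := h.smooth.continuousOn.mono fun x hx hx0 => by
    simp only [Set.mem_singleton_iff] at hx0
    simp [hx0] at hx
  obtain ⟨C, hC⟩ := (isCompact_sphere (0 : E) 1).exists_bound_of_continuousOn hc
  refine ⟨max C 0, le_max_right _ _, fun x hx => ?_⟩
  have hx' : 0 < ‖x‖ := norm_pos_iff.2 hx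
  have h1 : Φ x = (‖x‖ ^ d)⁻¹ • Φ (‖x‖⁻¹ • x) := by
    rw [← h.homog ‖x‖ hx' _ (smul_ne_zero (inv_ne_zero hx'.ne') hx), smul_smul,
      mul_inv_cancel₀ hx'.ne', one_smul]
  have h2 := hC (‖x‖⁻¹ • x) (by simp [norm_smul, hx'.ne'])
  rw [h1, norm_smul, Real.norm_of_nonneg (by positivity), mul_comm]
  gcongr
  exact h2.trans (le_max_left _ _)

end IsHomKernel

lemma exists_mul_one_add_norm_le_norm_sub {S : Set E} (hS : IsClosed S) {p : E} (hp : p ∉ S) :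
    ∃ ε > 0, ∃ c > 0, ∀ p' ∈ Metric.ball p ε, ∀ x ∈ S, c * (1 + ‖x‖) ≤ ‖p' - x‖ := by
  obtain ⟨δ, hδ, hball⟩ := Metric.isOpen_iff.1 hS.isOpen_compl p hp
  -- With D = ‖p' - x‖ and M = 1 + ‖p‖ + δ/2 one has D ≥ δ/2 and 1 + ‖x‖ ≤ D + M. The constant (δ/2)
  -- / (M + δ/2) turns these into the claim.
  refine ⟨δ / 2, by positivity, (δ / 2) / (1 + (‖p‖ + δ / 2) + δ / 2), by positivity,
    fun p' hp' x hx => ?_⟩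
  rw [Metric.mem_ball, dist_eq_norm] at hp'
  have h1 : δ ≤ ‖x - p‖ := by
    by_contra hlt
    exact hball (by rw [Metric.mem_ball, dist_eq_norm]; exact not_le.1 hlt) hx
  have h2 : ‖x - p‖ ≤ ‖p' - x‖ + ‖p' - p‖ := by
    rw [norm_sub_rev p' x]
    exact norm_sub_le_norm_sub_add_norm_sub x p' p
  have h3 : ‖x‖ ≤ ‖x - p‖ + ‖p‖ := by simpa using norm_add_le (x - p) p
  have h4 := norm_nonneg p
  rw [div_mul_eq_mul_div, div_le_iff₀ (by positivity)]
  nlinarith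

/-- The potential of the kernel `Φ` and of the image of the measure `ν` under `L`. -/
def potential {X : Type} [MeasurableSpace X] (ν : Measure X) (L : X → E) (Φ : E → F) (p : E) : F :=
  ∫ u, Φ (p - L u) ∂ν

variable {X : Type} [MeasurableSpace X]

/-- The image of the measure `ν` under `L` is carried by `S` and integrates
`(1 + ‖x‖)⁻ⁿ`. -/
structure IsSource (n : ℕ) (S : Set E) (ν : Measure X) (L : X → E) [MeasurableSpace E] :
    Prop where
  closed : IsClosed S
  meas : Measurable L
  mem : ∀ᵐ u ∂ν, L u ∈ S
  int : Integrable (fun u => ((1 + ‖L u‖) ^ n)⁻¹) ν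

variable [FiniteDimensional ℝ E] [MeasurableSpace E] [BorelSpace E]
  {n d : ℕ} {S : Set E} {ν : Measure X} {L : X → E} {Φ : E → F}

namespace IsSource

/-- The bound is uniform in p' near p, so it can serve as the dominating function for
differentiation under the integral. -/
lemma exists_bound (hs : IsSource n S ν L) (hΦ : IsHomKernel d Φ) (hd : n ≤ d) {p : E}
    (hp : p ∉ S) : ∃ ε > 0, ∃ C, 0 ≤ C ∧ ∀ p' ∈ Metric.ball p ε, ∀ x ∈ S,
      p' - x ≠ 0 ∧ ‖Φ (p' - x)‖ ≤ C * ((1 + ‖x‖) ^ n)⁻¹ := by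
  obtain ⟨ε, hε, c, hc, h⟩ := exists_mul_one_add_norm_le_norm_sub hs.closed hp
  obtain ⟨C, hC, hb⟩ := hΦ.exists_bound
  refine ⟨ε, hε, C * (c ^ d)⁻¹, by positivity, fun p' hp' x hx => ?_⟩
  have h1 := h p' hp' x hx
  have h2 : 0 < ‖p' - x‖ := lt_of_lt_of_le (by positivity) h1
  refine ⟨norm_pos_iff.1 h2, (hb _ (norm_pos_iff.1 h2)).trans ?_⟩
  rw [mul_assoc]
  gcongr
  rw [← mul_inv]
  gcongr
  calc c ^ d * (1 + ‖x‖) ^ n ≤ c ^ d * (1 + ‖x‖) ^ d := by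
        gcongr
        linarith [norm_nonneg x]
    _ = (c * (1 + ‖x‖)) ^ d := (mul_pow _ _ _).symm
    _ ≤ ‖p' - x‖ ^ d := by gcongr

lemma notMem_eventually (hs : IsSource n S ν L) {p : E} (hp : p ∉ S) :
    ∀ᶠ p' in nhds p, p' ∉ S := hs.closed.isOpen_compl.mem_nhds hp

/-- Nothing is known about Φ at the origin, so Φ need not be measurable. Measurability is obtained
only on S, where the argument never vanishes, and S carries the image measure. -/
lemma aestronglyMeasurable (hs : IsSource n S ν L) (hΦ : IsHomKernel d Φ) {p : E}
    (hp : p ∉ S) : AEStronglyMeasurable (fun u => Φ (p - L u)) ν := by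
  have h1 : ContinuousOn (fun x => Φ (p - x)) S :=
    hΦ.smooth.continuousOn.comp (by fun_prop) fun x hx h0 => by
      simp only [Set.mem_singleton_iff, sub_eq_zero] at h0
      exact hp (h0 ▸ hx)
  have h2 : AEStronglyMeasurable (fun x => Φ (p - x)) ((ν.map L).restrict S) :=
    h1.aestronglyMeasurable hs.closed.measurableSet
  rw [Measure.restrict_eq_self_of_ae_mem] at h2
  · exact h2.comp_measurable hs.meas
  · exact (ae_map_iff hs.meas.aemeasurable hs.closed.measurableSet).2 hs.mem

lemma integrable (hs : IsSource n S ν L) (hΦ : IsHomKernel d Φ) (hd : n ≤ d) {p : E}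
    (hp : p ∉ S) : Integrable (fun u => Φ (p - L u)) ν := by
  obtain ⟨ε, hε, C, -, h⟩ := hs.exists_bound hΦ hd hp
  refine (hs.int.const_mul C).mono' (hs.aestronglyMeasurable hΦ hp) ?_
  filter_upwards [hs.mem] with u hu using (h p (Metric.mem_ball_self hε) _ hu).2

lemma hasFDerivAt (hs : IsSource n S ν L) (hΦ : IsHomKernel d Φ) (hd : n ≤ d) {p : E}
    (hp : p ∉ S) : HasFDerivAt (potential ν L Φ) (potential ν L (fderiv ℝ Φ) p) p := by
  obtain ⟨ε, hε, C, -, h⟩ := hs.exists_bound hΦ.fderiv (hd.trans d.le_succ) hp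
  refine hasFDerivAt_integral_of_dominated_of_fderiv_le (s := Metric.ball p ε)
    (bound := fun u => C * ((1 + ‖L u‖) ^ n)⁻¹) (F := fun p u => Φ (p - L u))
    (F' := fun p u => fderiv ℝ Φ (p - L u))
    (Metric.ball_mem_nhds p hε) ?_ (hs.integrable hΦ hd hp) (hs.aestronglyMeasurable hΦ.fderiv hp)
    ?_ (hs.int.const_mul C) ?_
  · filter_upwards [hs.notMem_eventually hp] with p' hp' using hs.aestronglyMeasurable hΦ hp'
  · filter_upwards [hs.mem] with u hu p' hp' using (h p' hp' _ hu).2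
  · filter_upwards [hs.mem] with u hu p' hp'
    have := (hΦ.differentiableAt (h p' hp' _ hu).1).hasFDerivAt
    exact this.comp p' ((hasFDerivAt_id p').sub_const (L u))

lemma contDiffAt (hs : IsSource n S ν L) (hΦ : IsHomKernel d Φ) (hd : n ≤ d) {p : E}
    (hp : p ∉ S) : ContDiffAt ℝ ∞ (potential ν L Φ) p := by
  refine contDiffAt_infty.2 fun m => ?_
  -- The derivative is again a potential, with values in another space and with a kernel of degree d
  -- + 1. The target and the degree must therefore vary, and the condition n ≤ d survives.
  induction m generalizing F d with
  | zero =>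
    refine contDiffAt_zero.2 ⟨Sᶜ, hs.closed.isOpen_compl.mem_nhds hp, fun q hq => ?_⟩
    exact (hs.hasFDerivAt hΦ hd hq).continuousAt.continuousWithinAt
  | succ m ih =>
    push_cast
    refine contDiffAt_succ_iff_hasFDerivAt.2 ⟨potential ν L (fderiv ℝ Φ),
      ⟨Sᶜ, hs.closed.isOpen_compl.mem_nhds hp, fun q hq => hs.hasFDerivAt hΦ hd hq⟩, ?_⟩
    exact ih hΦ.fderiv (hd.trans d.le_succ)

lemma fderiv_apply (hs : IsSource n S ν L) {Φ : E → ℝ} (hΦ : IsHomKernel d Φ) (hd : n ≤ d)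
    {p : E} (hp : p ∉ S) (v : E) :
    fderiv ℝ (potential ν L Φ) p v = potential ν L (fun x => fderiv ℝ Φ x v) p := by
  rw [(hs.hasFDerivAt hΦ hd hp).fderiv]
  exact ContinuousLinearMap.integral_apply (hs.integrable hΦ.fderiv (hd.trans d.le_succ) hp) v

lemma fderiv_fderiv_apply (hs : IsSource n S ν L) {Φ : E → ℝ} (hΦ : IsHomKernel d Φ) (hd : n ≤ d)
    {p : E} (hp : p ∉ S) (v w : E) :
    fderiv ℝ (fun q => fderiv ℝ (potential ν L Φ) q v) p w =
      potential ν L (fun x => fderiv ℝ (fun y => fderiv ℝ Φ y v) x w) p := by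
  have h : (fun q => fderiv ℝ (potential ν L Φ) q v) =ᶠ[nhds p]
      potential ν L (fun x => fderiv ℝ Φ x v) := by
    filter_upwards [hs.notMem_eventually hp] with q hq using hs.fderiv_apply hΦ hd hq v
  rw [h.fderiv_eq, hs.fderiv_apply (hΦ.fderiv.clm_apply v) (hd.trans d.le_succ) hp w]

end IsSource
end HomKernel

/-! ### The cones of the discriminant locus -/

section Cones

variable {N : ℕ}

/-- The linear map `u ↦ ∑ u_k E_k`, where `E_0 = -(1, …, 1)` and `E_1, …, E_N` is the standard
basis of `ℝ^N`. -/
def coneMap : (Fin (N + 1) → ℝ) →ₗ[ℝ] Base N where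
  toFun u := (fun i => u i.succ - u 0, 0)
  map_add' u v := by ext <;> simp; ring
  map_smul' c u := by ext <;> simp; ring

lemma coneMap_apply (u : Fin (N + 1) → ℝ) : coneMap u = (fun i => u i.succ - u 0, 0) := rfl

/-- The vectors `E_0, …, E_N`. -/
def rayVec (c : Fin (N + 1)) : Base N := coneMap (Pi.single c 1)

lemma rayVec_zero : (rayVec 0 : Base N) = -oneVec N := by
  ext <;> simp [rayVec, coneMap_apply, oneVec]

lemma rayVec_succ (i : Fin N) : rayVec i.succ = ((Pi.single i 1, 0) : Base N) := by
  ext k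
  · by_cases h : k = i
    · subst h; simp [rayVec, coneMap_apply]
    · simp [rayVec, coneMap_apply, h]
  · simp [rayVec, coneMap_apply]

lemma rayVec_zero_eq_neg_sum : (rayVec 0 : Base N) = -∑ t : Fin N, (Pi.single t 1, 0) := by
  rw [rayVec_zero]
  ext k
  · simp [oneVec, Prod.fst_sum, Finset.sum_apply, Pi.single_apply]
  · simp [oneVec, Prod.snd_sum]

lemma continuous_coneMap : Continuous (coneMap : (Fin (N + 1) → ℝ) → Base N) :=
  coneMap.continuous_of_finiteDimensional

/-- The kernel of `coneMap` consists of the constant vectors, and a vanishing coordinate excludes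
these. Quantitatively, u_a = 0 bounds u_0 and then every u_k. -/
lemma norm_le_two_mul_norm_coneMap {u : Fin (N + 1) → ℝ} {a : Fin (N + 1)} (ha : u a = 0) :
    ‖u‖ ≤ 2 * ‖coneMap u‖ := by
  have hk (k : Fin N) : |u k.succ - u 0| ≤ ‖coneMap u‖ :=
    (norm_le_pi_norm (coneMap u).1 k).trans (norm_fst_le _)
  have h0 : |u 0| ≤ ‖coneMap u‖ := by
    refine Fin.cases (fun h => ?_) (fun i h => ?_) a ha
    · simp [h]
    · simpa [h] using hk i
  refine (pi_norm_le_iff_of_nonneg (by positivity)).2 fun k => ?_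
  rw [Real.norm_eq_abs]
  refine Fin.cases ?_ (fun i => ?_) k
  · linarith [norm_nonneg (coneMap u)]
  · have := abs_add_le (u i.succ - u 0) (u 0)
    rw [sub_add_cancel] at this
    linarith [hk i]

/-- The coordinates `(0, μ_1, …, μ_N)`. -/
def extendZero (p : Base N) : Fin (N + 1) → ℝ := Fin.cons 0 p.1

/-- The closed cone `{∑ u_k E_k | u ≥ 0, u_a = u_b = 0}`. -/
def discCone (a b : Fin (N + 1)) : Set (Base N) :=
  {p | p.2 = 0 ∧ ∀ k, extendZero p a ≤ extendZero p k ∧ extendZero p b ≤ extendZero p k}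

lemma continuous_extendZero (k : Fin (N + 1)) : Continuous fun p : Base N => extendZero p k := by
  refine Fin.cases ?_ (fun i => ?_) k
  · simp [extendZero, continuous_const]
  · simp only [extendZero, Fin.cons_succ]
    fun_prop

lemma isClosed_discCone (a b : Fin (N + 1)) : IsClosed (discCone a b : Set (Base N)) := by
  have h : (discCone a b : Set (Base N)) = {p | p.2 = 0} ∩ ⋂ k,
      ({p | extendZero p a ≤ extendZero p k} ∩ {p | extendZero p b ≤ extendZero p k}) := by
    ext p; simp [discCone]
  rw [h]
  exact (isClosed_eq continuous_snd continuous_const).inter <| isClosed_iInter fun k =>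
    (isClosed_le (continuous_extendZero a) (continuous_extendZero k)).inter
      (isClosed_le (continuous_extendZero b) (continuous_extendZero k))

lemma extendZero_coneMap (u : Fin (N + 1) → ℝ) (k : Fin (N + 1)) :
    extendZero (coneMap u) k = u k - u 0 := by
  refine Fin.cases ?_ (fun i => ?_) k <;> simp [extendZero, coneMap_apply]

lemma coneMap_mem_discCone {u : Fin (N + 1) → ℝ} {a b : Fin (N + 1)} (hu : ∀ k, 0 ≤ u k)
    (ha : u a = 0) (hb : u b = 0) : coneMap u ∈ discCone a b :=
  ⟨rfl, fun k => by simp only [extendZero_coneMap, ha, hb]; constructor <;> linarith [hu k]⟩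

/-- With u_k the k-th extended coordinate minus the a-th one, the point z_k = √(2 u_k) is a preimage
under the bundle map. Its zero set I contains a and b, but may be larger on the boundary of the
cone. Only this inclusion is needed, since all pointwise claims are proved off the cones, which are
closed. -/
lemma discCone_subset_discriminant {a b : Fin (N + 1)} (hab : a ≠ b) :
    discCone a b ⊆ discriminant N := by
  rintro p ⟨hp, h⟩
  set u : Fin (N + 1) → ℝ := fun k => extendZero p k - extendZero p a with hu
  have hu0 (k) : 0 ≤ u k := sub_nonneg.2 (h k).1
  have hua : u a = 0 := sub_self _
  have hub : u b = 0 := le_antisymm (sub_nonpos.2 (h a).2) (hu0 b)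
  classical
  simp only [discriminant, Set.mem_iUnion]
  refine ⟨Finset.univ.filter fun k => u k = 0, ?_, fun k => ((√(2 * u k) : ℝ) : ℂ), ⟨?_, ?_⟩, ?_⟩
  · exact Finset.one_lt_card.2 ⟨a, by simp [hua], b, by simp [hub], hab⟩
  · intro k hk
    simp only [Finset.mem_filter, Finset.mem_univ, true_and] at hk
    simp [hk]
  · intro k hk
    simp only [Finset.mem_filter, Finset.mem_univ, true_and] at hk
    have : 0 < u k := lt_of_le_of_ne (hu0 k) (Ne.symm hk)
    have : 0 < √(2 * u k) := Real.sqrt_pos.2 (by linarith)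
    exact Complex.ofReal_ne_zero.2 this.ne'
  · refine Prod.ext (funext fun i => ?_) ?_
    · simp only [bundleMap, Complex.norm_real, Real.norm_eq_abs, sq_abs]
      rw [Real.sq_sqrt (by linarith [hu0 i.succ]), Real.sq_sqrt (by linarith [hu0 0])]
      simp only [hu, extendZero, Fin.cons_succ, Fin.cons_zero]
      ring
    · simp only [bundleMap]
      rw [hp]
      exact Finset.prod_eq_zero (Finset.mem_univ a) (by simp [hua])

/-! ### Measures on the cones -/

/-- Lebesgue measure on the orthant `{u | u_k = 0 for k ∈ I, u_k > 0 for k ∉ I}`, one factor. -/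
def rayMeasure (I : Finset (Fin (N + 1))) (k : Fin (N + 1)) : Measure ℝ :=
  if k ∈ I then Measure.dirac 0 else volume.restrict (Set.Ioi 0)

instance (I : Finset (Fin (N + 1))) (k : Fin (N + 1)) : SigmaFinite (rayMeasure I k) := by
  unfold rayMeasure; split_ifs <;> infer_instance

/-- Lebesgue measure on the orthant `{u | u_k = 0 for k ∈ I, u_k > 0 for k ∉ I}`. -/
def faceMeasure (I : Finset (Fin (N + 1))) : Measure (Fin (N + 1) → ℝ) :=
  Measure.pi (rayMeasure I)

instance (I : Finset (Fin (N + 1))) : SigmaFinite (faceMeasure I) := by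
  unfold faceMeasure; infer_instance

lemma ae_rayMeasure (I : Finset (Fin (N + 1))) (k : Fin (N + 1)) :
    ∀ᵐ r ∂rayMeasure I k, 0 ≤ r ∧ (k ∈ I → r = 0) := by
  unfold rayMeasure
  split_ifs with h
  · refine (ae_dirac_iff ?_).2 ⟨le_rfl, fun _ => rfl⟩
    simp only [h, true_imp_iff]
    exact measurableSet_Ici.inter (measurableSet_singleton 0)
  · filter_upwards [ae_restrict_mem measurableSet_Ioi] with r hr
    exact ⟨(Set.mem_Ioi.1 hr).le, fun h' => absurd h' h⟩

lemma ae_faceMeasure (I : Finset (Fin (N + 1))) :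
    ∀ᵐ u ∂faceMeasure I, (∀ k, 0 ≤ u k) ∧ ∀ k ∈ I, u k = 0 := by
  have h : ∀ᵐ u ∂faceMeasure I, ∀ k, 0 ≤ u k ∧ (k ∈ I → u k = 0) :=
    ae_all_iff.2 fun k => (Measure.tendsto_eval_ae_ae (i := k)).eventually (ae_rayMeasure I k)
  filter_upwards [h] with u hu using ⟨fun k => (hu k).1, fun k hk => (hu k).2 hk⟩

/-- On the face the norms of u and of its image are comparable. The decay exponent N is then
distributed over the at most N - 1 free coordinates, each of which gets an exponent larger than 1.
-/
lemma integrable_faceMeasure (hN : 1 ≤ N) {I : Finset (Fin (N + 1))} (hI : 2 ≤ I.card) :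
    Integrable (fun u => ((1 + ‖(coneMap u : Base N)‖) ^ N)⁻¹) (faceMeasure I) := by
  have hN' : (1 : ℝ) ≤ N := by exact_mod_cast hN
  -- This exponent is integrable on a half-line, and (N - 1) s = N - 1/N does not exceed N.
  set s : ℝ := 1 + 1 / N with hs
  have hs1 : 1 < s := by
    have : (0 : ℝ) < 1 / N := by positivity
    linarith
  set f : Fin (N + 1) → ℝ → ℝ := fun k r => if k ∈ I then 1 else (1 + ‖r‖) ^ (-s) with hf
  have hint : Integrable (fun u : Fin (N + 1) → ℝ => ∏ k, f k (u k)) (faceMeasure I) := by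
    refine Integrable.fintype_prod fun k => ?_
    by_cases hk : k ∈ I
    · simp only [hf, hk, if_true, rayMeasure]
      exact integrable_const _
    · simp only [hf, hk, if_false, rayMeasure]
      exact (integrable_one_add_norm (by simpa using hs1)).integrableOn
  refine (hint.const_mul (2 ^ N)).mono'
    (Continuous.aestronglyMeasurable ?_) ?_
  · refine Continuous.inv₀ (by have := continuous_coneMap (N := N); fun_prop) fun u => ?_
    positivity
  obtain ⟨a, ha⟩ : I.Nonempty := Finset.card_pos.1 (by omega)
  filter_upwards [ae_faceMeasure I] with u hu
  rw [Real.norm_of_nonneg (by positivity)]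
  have h1 : 1 + ‖u‖ ≤ 2 * (1 + ‖(coneMap u : Base N)‖) := by
    linarith [norm_le_two_mul_norm_coneMap (hu.2 a ha)]
  have h2 : ((1 + ‖(coneMap u : Base N)‖) ^ N)⁻¹ ≤ 2 ^ N * ((1 + ‖u‖) ^ N)⁻¹ := by
    rw [← div_eq_mul_inv, inv_le_comm₀ (by positivity) (by positivity), inv_div,
      div_le_iff₀ (by positivity), mul_comm, ← mul_pow]
    gcongr
  refine h2.trans ?_
  gcongr
  have h3 : ∏ k, f k (u k) = ∏ k ∈ Finset.univ.filter (fun k => k ∉ I), (1 + ‖u k‖) ^ (-s) := by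
    rw [Finset.prod_filter]
    exact Finset.prod_congr rfl fun k _ => by by_cases hk : k ∈ I <;> simp [hf, hk]
  rw [h3]
  have hcard : ((Finset.univ.filter (fun k => k ∉ I)).card : ℝ) ≤ N - 1 := by
    have h4 := Finset.card_compl_add_card I
    rw [Fintype.card_fin] at h4
    have h5 : Finset.univ.filter (fun k => k ∉ I) = Iᶜ := by ext; simp
    rw [h5]
    have : (Iᶜ.card : ℝ) + I.card = N + 1 := by exact_mod_cast h4
    have : (2 : ℝ) ≤ I.card := by exact_mod_cast hI
    linarith
  calc ((1 + ‖u‖) ^ N)⁻¹ = (1 + ‖u‖) ^ (-(N : ℝ)) := by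
        rw [Real.rpow_neg (by positivity), Real.rpow_natCast]
    _ ≤ (1 + ‖u‖) ^ (-s * ((Finset.univ.filter (fun k => k ∉ I)).card : ℝ)) := by
        refine Real.rpow_le_rpow_of_exponent_le (by linarith [norm_nonneg u]) ?_
        have : s * ((Finset.univ.filter (fun k => k ∉ I)).card : ℝ) ≤ s * (N - 1) := by gcongr
        have h6 : s * (N - 1) = N - 1 / N := by rw [hs]; field_simp; ring
        have : (0 : ℝ) ≤ 1 / N := by positivity
        linarith
    _ = ∏ k ∈ Finset.univ.filter (fun k => k ∉ I), (1 + ‖u‖) ^ (-s) := by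
        rw [Finset.prod_const, Real.rpow_mul (by positivity), Real.rpow_natCast]
    _ ≤ _ := by
        refine Finset.prod_le_prod (fun k _ => by positivity) fun k _ => ?_
        refine Real.rpow_le_rpow_of_nonpos (by positivity) ?_ (by linarith)
        linarith [norm_le_pi_norm u k]

lemma isSource_faceMeasure (hN : 1 ≤ N) {a b : Fin (N + 1)} {I : Finset (Fin (N + 1))}
    (hab : a ≠ b) (ha : a ∈ I) (hb : b ∈ I) :
    IsSource N (discCone a b) (faceMeasure I) (coneMap : _ → Base N) where
  closed := isClosed_discCone a b
  meas := continuous_coneMap.measurable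
  mem := by
    filter_upwards [ae_faceMeasure I] with u hu
      using coneMap_mem_discCone hu.1 (hu.2 a ha) (hu.2 b hb)
  int := integrable_faceMeasure hN (Finset.one_lt_card.2 ⟨a, ha, b, hb, hab⟩)

/-- The fundamental theorem of calculus along the ray `E_c` of the cone over the face `I`. -/
lemma integral_fderiv_rayVec (hN : 1 ≤ N) {I : Finset (Fin (N + 1))} (hI : I.Nonempty)
    {c : Fin (N + 1)} (hc : c ∉ I) {G : Base N → ℝ} {C : ℝ}
    (hG : ∀ u : Fin (N + 1) → ℝ, (∀ k, 0 ≤ u k) → (∀ k ∈ I, u k = 0) →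
      DifferentiableAt ℝ G (coneMap u) ∧ ‖G (coneMap u)‖ ≤ C * ((1 + ‖(coneMap u : Base N)‖) ^ N)⁻¹)
    (hint : Integrable (fun u => fderiv ℝ G (coneMap u) (rayVec c)) (faceMeasure I)) :
    ∫ u, fderiv ℝ G (coneMap u) (rayVec c) ∂faceMeasure I =
      -∫ u, G (coneMap u) ∂faceMeasure (insert c I) := by
  set e := MeasurableEquiv.piFinSuccAbove (fun _ : Fin (N + 1) => ℝ) c with he
  set ρ : Measure (Fin N → ℝ) := Measure.pi fun j => rayMeasure I (c.succAbove j) with hρ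
  -- The measures of the faces I and `insert c I` differ only in the factor c, which changes from
  -- Lebesgue measure on the half-line to the Dirac measure at 0. Evaluation of the primitive at r =
  -- 0 is integration against this Dirac measure.
  have hρ' : (Measure.pi fun j => rayMeasure (insert c I) (c.succAbove j)) = ρ := by
    rw [hρ]
    congr 1
    ext1 j
    simp [rayMeasure, Fin.succAbove_ne]
  have mp1 : MeasurePreserving e (faceMeasure I) ((volume.restrict (Set.Ioi 0)).prod ρ) := by
    have := measurePreserving_piFinSuccAbove (rayMeasure I) c
    rwa [show rayMeasure I c = volume.restrict (Set.Ioi 0) by simp [rayMeasure, hc]] at this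
  have mp2 : MeasurePreserving e (faceMeasure (insert c I)) ((Measure.dirac 0).prod ρ) := by
    have := measurePreserving_piFinSuccAbove (rayMeasure (insert c I)) c
    rwa [show rayMeasure (insert c I) c = Measure.dirac 0 by simp [rayMeasure], hρ'] at this
  have hρae : ∀ᵐ v ∂ρ, (∀ j, 0 ≤ v j) ∧ ∀ j, c.succAbove j ∈ I → v j = 0 := by
    have h : ∀ᵐ v ∂ρ, ∀ j, 0 ≤ v j ∧ (c.succAbove j ∈ I → v j = 0) :=
      ae_all_iff.2 fun j =>
        (Measure.tendsto_eval_ae_ae (μ := fun j => rayMeasure I (c.succAbove j))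
          (i := j)).eventually (ae_rayMeasure I (c.succAbove j))
    filter_upwards [h] with v hv using ⟨fun j => (hv j).1, fun j => (hv j).2⟩
  have hint' : Integrable (fun z : ℝ × (Fin N → ℝ) =>
      fderiv ℝ G (coneMap (c.insertNth z.1 z.2 : Fin (N + 1) → ℝ)) (rayVec c))
      ((volume.restrict (Set.Ioi 0)).prod ρ) :=
    (mp1.symm.integrable_comp_emb e.symm.measurableEmbedding).2 hint
  have hL : ∫ u, fderiv ℝ G (coneMap u) (rayVec c) ∂faceMeasure I =
      ∫ v, (∫ r in Set.Ioi 0,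
        fderiv ℝ G (coneMap (c.insertNth r v : Fin (N + 1) → ℝ)) (rayVec c)) ∂ρ := by
    rw [← mp1.symm.integral_comp e.symm.measurableEmbedding]
    exact integral_prod_symm _ hint'
  have hR : ∫ u, G (coneMap u) ∂faceMeasure (insert c I) =
      ∫ v, G (coneMap (c.insertNth 0 v)) ∂ρ := by
    rw [← mp2.symm.integral_comp e.symm.measurableEmbedding, Measure.dirac_prod,
      MeasurableEmbedding.integral_map]
    · rfl
    · exact measurableEmbedding_prodMk_left 0
  rw [hL, hR, ← integral_neg]
  refine integral_congr_ae ?_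
  filter_upwards [hρae, hint'.prod_left_ae] with v hv hvint
  have hcm (r : ℝ) : (coneMap (c.insertNth r v : Fin (N + 1) → ℝ) : Base N) =
      coneMap (c.insertNth 0 v) + r • rayVec c := by
    rw [rayVec, ← map_smul, ← map_add]
    congr 1
    ext k
    refine Fin.succAboveCases c ?_ (fun j => ?_) k <;> simp
  have hpos (r : ℝ) (hr : 0 ≤ r) : (∀ k, 0 ≤ (c.insertNth r v : Fin (N + 1) → ℝ) k) ∧
      ∀ k ∈ I, (c.insertNth r v : Fin (N + 1) → ℝ) k = 0 := by
    refine ⟨fun k => ?_, fun k => ?_⟩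
    · refine Fin.succAboveCases c ?_ (fun j => ?_) k
      · simpa using hr
      · simpa using hv.1 j
    · refine Fin.succAboveCases c (fun h => absurd h hc) (fun j hj => ?_) k
      simpa using hv.2 j hj
  have hderiv (r : ℝ) (hr : 0 ≤ r) : HasDerivAt (fun r => G (coneMap (c.insertNth r v)))
      (fderiv ℝ G (coneMap (c.insertNth r v : Fin (N + 1) → ℝ)) (rayVec c)) r := by
    have h1 := (hG _ (hpos r hr).1 (hpos r hr).2).1.hasFDerivAt
    have h2 : HasDerivAt (fun r : ℝ => (coneMap (c.insertNth r v) : Base N)) (rayVec c) r := by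
      have h3 := ((hasDerivAt_id r).smul_const (rayVec c : Base N)).const_add
        (coneMap (c.insertNth 0 v : Fin (N + 1) → ℝ))
      rw [one_smul] at h3
      exact h3.congr_of_eventuallyEq (Filter.Eventually.of_forall hcm)
    exact h1.comp_hasDerivAt r h2
  obtain ⟨a, ha⟩ := hI
  -- Some coordinate in I vanishes, so the ray leaves every bounded set. Since N ≥ 1, one power of
  -- the decay already forces the limit 0.
  have htend : Filter.Tendsto (fun r => G (coneMap (c.insertNth r v))) Filter.atTop (nhds 0) := by
    refine squeeze_zero_norm' (a := fun r => |C| * (1 + r / 2)⁻¹) ?_ ?_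
    · filter_upwards [Filter.eventually_ge_atTop 0] with r hr
      have h1 := (hG _ (hpos r hr).1 (hpos r hr).2).2
      have h2 : r / 2 ≤ ‖(coneMap (c.insertNth r v) : Base N)‖ := by
        have h3 := norm_le_two_mul_norm_coneMap ((hpos r hr).2 a ha)
        have h4 := norm_le_pi_norm (c.insertNth r v : Fin (N + 1) → ℝ) c
        simp only [Fin.insertNth_apply_same, Real.norm_of_nonneg hr] at h4
        linarith
      refine h1.trans ?_
      refine mul_le_mul (le_abs_self C) ?_ (by positivity) (abs_nonneg C)
      gcongr
      calc 1 + r / 2 ≤ 1 + ‖(coneMap (c.insertNth r v) : Base N)‖ := by linarith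
        _ ≤ _ := le_self_pow₀ (by linarith [norm_nonneg (coneMap (c.insertNth r v) : Base N)])
          (by omega)
    · rw [← mul_zero |C|]
      refine Filter.Tendsto.const_mul _ (tendsto_inv_atTop_zero.comp ?_)
      exact Filter.tendsto_atTop_add_const_left _ _
        (Filter.tendsto_id.atTop_div_const (by norm_num))
  rw [integral_Ioi_of_hasDerivAt_of_tendsto
    (hderiv 0 le_rfl).continuousAt.continuousWithinAt (fun r hr => hderiv r (le_of_lt hr))
    hvint htend, zero_sub]

/-! ### Comparison with the given parametrizations -/

/-- Insertion of zeros at the places `0` and `i`. -/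
def insertZeros0 (i : Fin N) (t : Param0 i) : Fin (N + 1) → ℝ :=
  Fin.cons 0 fun k => if h : k ≠ i then t ⟨k, h⟩ else 0

/-- Insertion of zeros at the places `i` and `j`. -/
def insertZeros (i j : Fin N) (q : Param i j) : Fin (N + 1) → ℝ :=
  Fin.cons q.1 fun k => if h : k ≠ i ∧ k ≠ j then q.2 ⟨k, h⟩ else 0

lemma coneMap_insertZeros0 (i : Fin N) (t : Param0 i) :
    coneMap (insertZeros0 i t) = tVec0 i t := by
  ext <;> simp [coneMap_apply, insertZeros0, tVec0]

lemma coneMap_insertZeros (i j : Fin N) (q : Param i j) :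
    coneMap (insertZeros i j q) = tVec i j q - q.1 • oneVec N := by
  ext <;> simp [coneMap_apply, insertZeros, tVec, oneVec]

lemma continuous_insertZeros0 (i : Fin N) : Continuous (insertZeros0 i) := by
  refine continuous_pi fun k => Fin.cases ?_ (fun k => ?_) k
  · simp [insertZeros0, continuous_const]
  · simp only [insertZeros0, Fin.cons_succ]
    split_ifs <;> fun_prop

lemma continuous_insertZeros (i j : Fin N) : Continuous (insertZeros i j) := by
  refine continuous_pi fun k => Fin.cases ?_ (fun k => ?_) k
  · simp only [insertZeros, Fin.cons_zero]
    fun_prop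
  · simp only [insertZeros, Fin.cons_succ]
    split_ifs <;> fun_prop

lemma prod_rayMeasure_subtype {I : Finset (Fin (N + 1))} {s : Fin (N + 1) → Set ℝ}
    (h0 : ∀ k ∈ I, (0 : ℝ) ∈ s k) (hs : ∀ k, MeasurableSet (s k)) (P : Fin N → Prop)
    [DecidablePred P] (hP : ∀ k, P k ↔ k.succ ∉ I) :
    ∏ k : Fin N, rayMeasure I k.succ (s k.succ) =
      ∏ k : {k // P k}, volume.restrict (Set.Ioi 0) (s k.1.succ) := by
  rw [← Fintype.prod_subtype_mul_prod_subtype P]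
  rw [Finset.prod_eq_one (s := (Finset.univ : Finset {k // ¬P k})), mul_one]
  · exact Finset.prod_congr rfl fun k _ => by simp [rayMeasure, (hP k.1).1 k.2]
  · rintro ⟨k, hk⟩ -
    have hk' : k.succ ∈ I := not_not.1 fun h => hk ((hP k).2 h)
    simp [rayMeasure, hk', Measure.dirac_apply' _ (hs _), h0 _ hk']

lemma prod_rayMeasure_eq_zero {I : Finset (Fin (N + 1))} {s : Fin (N + 1) → Set ℝ}
    (hs : ∀ k, MeasurableSet (s k)) {k : Fin (N + 1)} (hk : k ∈ I) (h0 : (0 : ℝ) ∉ s k) :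
    ∏ k, rayMeasure I k (s k) = 0 :=
  Finset.prod_eq_zero (Finset.mem_univ k) (by
    simp [rayMeasure, hk, Measure.dirac_apply' _ (hs _), h0])

lemma restrict_orthant0 (i : Fin N) : volume.restrict (orthant0 i) =
    Measure.pi fun _ : {k : Fin N // k ≠ i} => (volume.restrict (Set.Ioi 0) : Measure ℝ) := by
  rw [← Measure.restrict_pi_pi]
  congr 1
  ext t; simp [orthant0]

lemma restrict_orthant (i j : Fin N) : volume.restrict (orthant i j) =
    (volume.restrict (Set.Ioi 0) : Measure ℝ).prod (Measure.pi
      fun _ : {k : Fin N // k ≠ i ∧ k ≠ j} => (volume.restrict (Set.Ioi 0) : Measure ℝ)) := by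
  rw [← Measure.restrict_pi_pi, Measure.prod_restrict]
  congr 1
  ext t; simp [orthant]

/-- A product measure is determined by its values on boxes. A box that misses 0 in a Dirac
coordinate has measure zero on both sides. Otherwise the Dirac factors equal 1 and the free factors
agree. -/
lemma map_insertZeros0 (i : Fin N) :
    (volume.restrict (orthant0 i)).map (insertZeros0 i) = faceMeasure {0, i.succ} := by
  refine (Measure.pi_eq fun s hs => ?_).symm
  rw [Measure.map_apply (continuous_insertZeros0 i).measurable (MeasurableSet.univ_pi hs),
    restrict_orthant0]
  by_cases h : ∀ k ∈ ({0, i.succ} : Finset (Fin (N + 1))), (0 : ℝ) ∈ s k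
  · rw [Fin.prod_univ_succ, prod_rayMeasure_subtype h hs (fun k => k ≠ i)
      (fun k => by simp [Fin.succ_ne_zero]), ← Measure.pi_pi]
    have h00 : (0 : ℝ) ∈ s 0 := h 0 (by simp)
    have h0i : (0 : ℝ) ∈ s i.succ := h i.succ (by simp)
    have h1 : rayMeasure {0, i.succ} 0 (s 0) = 1 := by
      simp [rayMeasure, Measure.dirac_apply' _ (hs _), h00]
    rw [h1, one_mul]
    congr 1
    ext t
    simp only [Set.mem_preimage, Set.mem_univ_pi, Fin.forall_fin_succ, insertZeros0, Fin.cons_zero,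
      Fin.cons_succ, h00, true_and, Subtype.forall]
    refine forall_congr' fun k => ?_
    by_cases hk : k = i
    · subst hk; simp [h0i]
    · simp [hk]
  · push Not at h
    obtain ⟨k, hk, h0⟩ := h
    rw [prod_rayMeasure_eq_zero hs hk h0]
    refine (congrArg _ ?_).trans (measure_empty (μ := Measure.pi _))
    refine Set.eq_empty_of_forall_notMem fun t ht => h0 ?_
    have := ht k (Set.mem_univ k)
    simp only [Finset.mem_insert, Finset.mem_singleton] at hk
    obtain rfl | rfl := hk <;> simpa [insertZeros0] using this

lemma map_insertZeros (i j : Fin N) :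
    (volume.restrict (orthant i j)).map (insertZeros i j) = faceMeasure {i.succ, j.succ} := by
  refine (Measure.pi_eq fun s hs => ?_).symm
  rw [Measure.map_apply (continuous_insertZeros i j).measurable (MeasurableSet.univ_pi hs),
    restrict_orthant]
  by_cases h : ∀ k ∈ ({i.succ, j.succ} : Finset (Fin (N + 1))), (0 : ℝ) ∈ s k
  · rw [Fin.prod_univ_succ, prod_rayMeasure_subtype h hs (fun k => k ≠ i ∧ k ≠ j)
      (fun k => by simp), ← Measure.pi_pi]
    have h0i : (0 : ℝ) ∈ s i.succ := h i.succ (by simp)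
    have h0j : (0 : ℝ) ∈ s j.succ := h j.succ (by simp)
    have h1 : rayMeasure {i.succ, j.succ} 0 = volume.restrict (Set.Ioi 0) := by
      simp [rayMeasure, (Fin.succ_ne_zero _).symm]
    rw [h1, ← Measure.prod_prod]
    congr 1
    ext t
    simp only [Set.mem_preimage, Set.mem_univ_pi, Fin.forall_fin_succ, insertZeros, Fin.cons_zero,
      Fin.cons_succ, Set.mem_prod, Subtype.forall]
    refine and_congr_right fun _ => forall_congr' fun k => ?_
    by_cases hk : k ≠ i ∧ k ≠ j
    · simp [hk]
    · simp only [hk, dif_neg, not_false_eq_true, IsEmpty.forall_iff, iff_true]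
      by_cases hki : k = i
      · exact hki ▸ h0i
      · have : k = j := by tauto
        exact this ▸ h0j
  · push Not at h
    obtain ⟨k, hk, h0⟩ := h
    rw [prod_rayMeasure_eq_zero hs hk h0]
    refine (congrArg _ ?_).trans (measure_empty (μ := Measure.prod _ _))
    refine Set.eq_empty_of_forall_notMem fun t ht => h0 ?_
    have := ht k (Set.mem_univ k)
    simp only [Finset.mem_insert, Finset.mem_singleton] at hk
    obtain rfl | rfl := hk <;> simpa [insertZeros] using this

lemma integrableOn_orthant0 (i : Fin N) {g : Base N → ℝ}
    (hg : Integrable (fun u => g (coneMap u)) (faceMeasure {0, i.succ})) :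
    IntegrableOn (fun t => g (tVec0 i t)) (orthant0 i) := by
  rw [← map_insertZeros0] at hg
  have h := hg.comp_measurable (continuous_insertZeros0 i).measurable
  simpa only [Function.comp_def, coneMap_insertZeros0, IntegrableOn] using h

lemma integrableOn_orthant (i j : Fin N) {g : Base N → ℝ}
    (hg : Integrable (fun u => g (coneMap u)) (faceMeasure {i.succ, j.succ})) :
    IntegrableOn (fun q => g (tVec i j q - q.1 • oneVec N)) (orthant i j) := by
  rw [← map_insertZeros] at hg
  have h := hg.comp_measurable (continuous_insertZeros i j).measurable
  simpa only [Function.comp_def, coneMap_insertZeros, IntegrableOn] using h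

lemma integral_orthant0 (i : Fin N) {g : Base N → ℝ}
    (hg : AEStronglyMeasurable (fun u => g (coneMap u)) (faceMeasure {0, i.succ})) :
    ∫ t in orthant0 i, g (tVec0 i t) = ∫ u, g (coneMap u) ∂faceMeasure {0, i.succ} := by
  rw [← map_insertZeros0] at hg ⊢
  rw [integral_map (continuous_insertZeros0 i).aemeasurable hg]
  simp only [coneMap_insertZeros0]

lemma integral_orthant (i j : Fin N) {g : Base N → ℝ}
    (hg : AEStronglyMeasurable (fun u => g (coneMap u)) (faceMeasure {i.succ, j.succ})) :
    ∫ q in orthant i j, g (tVec i j q - q.1 • oneVec N) =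
      ∫ u, g (coneMap u) ∂faceMeasure {i.succ, j.succ} := by
  rw [← map_insertZeros] at hg ⊢
  rw [integral_map (continuous_insertZeros i j).aemeasurable hg]
  simp only [coneMap_insertZeros]

end Cones

/-! ### The regularized Newton kernel -/

section Newton

variable {N : ℕ} {A : Matrix (Fin N) (Fin N) ℝ}

/-- The quadratic form `|p|_A²`. -/
def quadForm (A : Matrix (Fin N) (Fin N) ℝ) (p : Base N) : ℝ :=
  (∑ i, ∑ j, A i j * p.1 i * p.1 j) + A.det * ‖p.2‖ ^ 2

/-- The inner product of the metric `g_A`. -/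
def bilForm (A : Matrix (Fin N) (Fin N) ℝ) (p v : Base N) : ℝ :=
  (∑ i, ∑ j, A i j * p.1 i * v.1 j) + A.det * (p.2.re * v.2.re + p.2.im * v.2.im)

/-- The kernel `(|p|_A² + e)^{-N/2}`. -/
def newtonKernel (A : Matrix (Fin N) (Fin N) ℝ) (e : ℝ) (p : Base N) : ℝ :=
  (quadForm A p + e) ^ (-(N / 2 : ℝ))

lemma quadForm_eq_bilForm (p : Base N) : quadForm A p = bilForm A p p := by
  rw [quadForm, bilForm, ← Complex.normSq_eq_norm_sq, Complex.normSq_apply]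

lemma bilForm_symm (hA : A.PosDef) (p v : Base N) : bilForm A p v = bilForm A v p := by
  have h (i j) : A i j = A j i := by simpa using (hA.isHermitian.apply j i)
  rw [bilForm, bilForm, Finset.sum_comm]
  congr 1
  · exact Finset.sum_congr rfl fun i _ => Finset.sum_congr rfl fun j _ => by rw [h]; ring
  · ring

lemma bilForm_add_smul_left (p v w : Base N) (t : ℝ) :
    bilForm A (p + t • w) v = bilForm A p v + t * bilForm A w v := by
  simp only [bilForm, Prod.fst_add, Prod.smul_fst, Pi.add_apply, Pi.smul_apply, smul_eq_mul,
    Prod.snd_add, Prod.smul_snd, Complex.add_re, Complex.add_im, Complex.real_smul,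
    Complex.mul_re, Complex.mul_im, Complex.ofReal_re, Complex.ofReal_im, mul_add, add_mul,
    Finset.sum_add_distrib, Finset.mul_sum]
  have : ∀ i j, A i j * (t * w.1 i) * v.1 j = t * (A i j * w.1 i * v.1 j) := fun i j => by ring
  simp only [this]
  ring

lemma quadForm_add_smul (hA : A.PosDef) (p v : Base N) (t : ℝ) :
    quadForm A (p + t • v) = quadForm A p + 2 * t * bilForm A p v + t ^ 2 * quadForm A v := by
  simp only [quadForm_eq_bilForm]
  rw [bilForm_add_smul_left, bilForm_symm hA p, bilForm_add_smul_left,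
    bilForm_symm hA v (p + t • v), bilForm_add_smul_left, bilForm_symm hA v p]
  ring

lemma contDiff_quadForm {n : WithTop ℕ∞} : ContDiff ℝ n (quadForm A) := by
  unfold quadForm
  refine ContDiff.add ?_ (contDiff_const.mul (contDiff_snd.norm_sq ℝ))
  exact ContDiff.sum fun i _ => ContDiff.sum fun j _ => by fun_prop

lemma quadForm_pos (hA : A.PosDef) {p : Base N} (hp : p ≠ 0) : 0 < quadForm A p := by
  have h1 : (∑ i, ∑ j, A i j * p.1 i * p.1 j) = dotProduct (star p.1) (A.mulVec p.1) := by
    simp only [dotProduct, Matrix.mulVec, Finset.mul_sum, star_trivial]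
    exact Finset.sum_congr rfl fun i _ => Finset.sum_congr rfl fun j _ => by ring
  rw [quadForm, h1]
  have hdet := hA.det_pos
  by_cases h : p.1 = 0
  · have h2 : p.2 ≠ 0 := fun h2 => hp (Prod.ext h h2)
    have : 0 < ‖p.2‖ := norm_pos_iff.2 h2
    simp only [h, star_zero, zero_dotProduct, zero_add]
    positivity
  · have := hA.dotProduct_mulVec_pos h
    positivity

lemma quadForm_zero : quadForm A 0 = 0 := by simp [quadForm]

lemma quadForm_nonneg (hA : A.PosDef) (p : Base N) : 0 ≤ quadForm A p := by
  by_cases hp : p = 0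
  · rw [hp, quadForm_zero]
  · exact (quadForm_pos hA hp).le

lemma quadForm_smul (c : ℝ) (p : Base N) : quadForm A (c • p) = c ^ 2 * quadForm A p := by
  simp only [quadForm, Prod.smul_fst, Pi.smul_apply, smul_eq_mul, Prod.smul_snd, norm_smul,
    mul_add, Finset.mul_sum, Real.norm_eq_abs, mul_pow, sq_abs]
  congr 1
  · exact Finset.sum_congr rfl fun i _ => Finset.sum_congr rfl fun j _ => by ring
  · ring

lemma quadForm_neg (p : Base N) : quadForm A (-p) = quadForm A p := by
  simpa using quadForm_smul (A := A) (-1) p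

lemma newtonKernel_neg (e : ℝ) (p : Base N) : newtonKernel A e (-p) = newtonKernel A e p := by
  simp [newtonKernel, quadForm_neg]

lemma one_div_normA_pow (hA : A.PosDef) (p : Base N) :
    1 / normA A p ^ N = newtonKernel A 0 p := by
  have h := quadForm_nonneg hA p
  rw [newtonKernel, add_zero, Real.rpow_neg h, one_div]
  congr 1
  change (√(quadForm A p)) ^ N = _
  rw [Real.sqrt_eq_rpow, ← Real.rpow_natCast, ← Real.rpow_mul h]
  congr 1
  ring

lemma contDiffAt_rpow_quadForm {e : ℝ} {p : Base N} (hp : 0 < quadForm A p + e) (s : ℝ)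
    {n : WithTop ℕ∞} : ContDiffAt ℝ n (fun p => (quadForm A p + e) ^ s) p :=
  (contDiff_quadForm.contDiffAt.add contDiffAt_const).rpow_const_of_ne hp.ne'

lemma isHomKernel_newtonKernel (hA : A.PosDef) : IsHomKernel N (newtonKernel A 0) where
  smooth p hp := (contDiffAt_rpow_quadForm (by simpa using quadForm_pos hA hp) _).contDiffWithinAt
  homog c hc p hp := by
    simp only [newtonKernel, add_zero, quadForm_smul, smul_eq_mul]
    rw [Real.mul_rpow (by positivity) (quadForm_nonneg hA p)]
    congr 1
    rw [← Real.rpow_natCast c 2, ← Real.rpow_mul hc.le, ← Real.rpow_natCast c N,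
      ← Real.rpow_neg hc.le]
    congr 1
    push_cast
    ring

/-- This reduces the derivatives of the kernel to one-variable calculus along lines, where the
quadratic form is a polynomial in t. -/
lemma fderiv_eq_of_hasDerivAt {f : Base N → ℝ} {p v : Base N} {f' : ℝ}
    (hf : DifferentiableAt ℝ f p) (h : HasDerivAt (fun t : ℝ => f (p + t • v)) f' 0) :
    fderiv ℝ f p v = f' := by
  rw [← hf.lineDeriv_eq_fderiv]
  exact h.deriv

lemma hasDerivAt_quadForm (hA : A.PosDef) (p v : Base N) :
    HasDerivAt (fun t : ℝ => quadForm A (p + t • v)) (2 * bilForm A p v) 0 := by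
  simp only [quadForm_add_smul hA]
  have h := (((hasDerivAt_id (0 : ℝ)).const_mul (2 * bilForm A p v)).const_add (quadForm A p)).add
    (((hasDerivAt_id (0 : ℝ)).pow 2).mul_const (quadForm A v))
  simp only [Pi.pow_apply, id_eq, mul_one, Nat.cast_ofNat, Nat.add_one_sub_one, pow_one,
    mul_zero, zero_mul, add_zero] at h
  refine h.congr_of_eventuallyEq (Filter.Eventually.of_forall fun t => ?_)
  simp only [Pi.add_apply]
  ring

lemma hasDerivAt_rpow_quadForm (hA : A.PosDef) {e : ℝ} {p : Base N} (hp : 0 < quadForm A p + e)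
    (s : ℝ) (v : Base N) : HasDerivAt (fun t : ℝ => (quadForm A (p + t • v) + e) ^ s)
      (2 * bilForm A p v * s * (quadForm A p + e) ^ (s - 1)) 0 := by
  have h := ((hasDerivAt_quadForm hA p v).add_const e).rpow_const (p := s)
    (by left; simpa using hp.ne')
  simpa using h

lemma fderiv_newtonKernel (hA : A.PosDef) {e : ℝ} {p : Base N} (hp : 0 < quadForm A p + e)
    (v : Base N) : fderiv ℝ (newtonKernel A e) p v =
      -N * (bilForm A p v * (quadForm A p + e) ^ (-(N / 2 : ℝ) - 1)) := by
  refine (fderiv_eq_of_hasDerivAt ((contDiffAt_rpow_quadForm hp _).differentiableAt one_ne_zero)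
    (hasDerivAt_rpow_quadForm hA hp _ v)).trans ?_
  ring

lemma contDiff_bilForm {n : WithTop ℕ∞} (v : Base N) : ContDiff ℝ n (fun p => bilForm A p v) := by
  unfold bilForm
  refine ContDiff.add ?_ (contDiff_const.mul (ContDiff.add ?_ ?_))
  · exact ContDiff.sum fun i _ => ContDiff.sum fun j _ => by fun_prop
  · exact (Complex.reCLM.contDiff.comp contDiff_snd).mul contDiff_const
  · exact (Complex.imCLM.contDiff.comp contDiff_snd).mul contDiff_const

lemma fderiv_fderiv_newtonKernel (hA : A.PosDef) {e : ℝ} {p : Base N} (hp : 0 < quadForm A p + e)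
    (v w : Base N) : fderiv ℝ (fun p => fderiv ℝ (newtonKernel A e) p v) p w =
      N * (quadForm A p + e) ^ (-(N / 2 : ℝ) - 2) *
        ((N + 2) * (bilForm A p v * bilForm A p w) - (quadForm A p + e) * bilForm A w v) := by
  have hev : (fun p => fderiv ℝ (newtonKernel A e) p v) =ᶠ[nhds p] fun p =>
      -N * (bilForm A p v * (quadForm A p + e) ^ (-(N / 2 : ℝ) - 1)) := by
    have : ∀ᶠ p in nhds p, 0 < quadForm A p + e :=
      (contDiff_quadForm (n := 0).continuous.add continuous_const).continuousAt.eventually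
        (lt_mem_nhds hp)
    filter_upwards [this] with q hq using fderiv_newtonKernel hA hq v
  rw [hev.fderiv_eq]
  have h1 : HasDerivAt (fun t : ℝ => bilForm A (p + t • w) v) (bilForm A w v) 0 := by
    simp only [bilForm_add_smul_left]
    simpa using ((hasDerivAt_id (0 : ℝ)).mul_const (bilForm A w v)).const_add (bilForm A p v)
  have h2 := (h1.mul (hasDerivAt_rpow_quadForm hA hp (-(N / 2 : ℝ) - 1) w)).const_mul (-N : ℝ)
  rw [fderiv_eq_of_hasDerivAt _ h2]
  · have h3 : (quadForm A p + e) ^ (-(N / 2 : ℝ) - 1) =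
        (quadForm A p + e) * (quadForm A p + e) ^ (-(N / 2 : ℝ) - 2) := by
      rw [← Real.rpow_one_add' hp.le]
      · congr 1; ring
      · have : (0 : ℝ) ≤ N := by positivity
        intro h
        linarith
    simp only [zero_smul, add_zero]
    rw [show -(N / 2 : ℝ) - 1 - 1 = -(N / 2 : ℝ) - 2 by ring, h3]
    ring
  · exact (contDiffAt_const.mul ((contDiff_bilForm v).contDiffAt.mul
      (contDiffAt_rpow_quadForm hp _))).differentiableAt one_ne_zero

/-- The pairings of p with the basis vectors form the vector μA, and contracting it with itself
through A⁻¹ gives μ A A⁻¹ Aμ = μAμ. -/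
lemma sum_inv_mul_bilForm (hA : A.PosDef) (p : Base N) :
    ∑ i, ∑ j, A⁻¹ i j * (bilForm A p (Pi.single j 1, 0) * bilForm A p (Pi.single i 1, 0)) =
      ∑ i, ∑ j, A i j * p.1 i * p.1 j := by
  have hdet : IsUnit A.det := hA.det_pos.ne'.isUnit
  have h1 (k : Fin N) : bilForm A p (Pi.single k 1, 0) = Matrix.vecMul p.1 A k := by
    simp only [bilForm, Pi.single_apply, mul_ite, mul_one, mul_zero, Finset.sum_ite_eq',
      Finset.mem_univ, if_true, Complex.zero_re, Complex.zero_im, add_zero, Matrix.vecMul,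
      dotProduct]
    exact Finset.sum_congr rfl fun i _ => by ring
  have h2 : ∀ u : Fin N → ℝ, ∑ i, ∑ j, A⁻¹ i j * (u j * u i) = dotProduct u (A⁻¹.mulVec u) := by
    intro u
    simp only [dotProduct, Matrix.mulVec, Finset.mul_sum]
    exact Finset.sum_congr rfl fun i _ => Finset.sum_congr rfl fun j _ => by ring
  have h3 : ∑ i, ∑ j, A i j * p.1 i * p.1 j = dotProduct p.1 (A.mulVec p.1) := by
    simp only [dotProduct, Matrix.mulVec, Finset.mul_sum]
    exact Finset.sum_congr rfl fun i _ => Finset.sum_congr rfl fun j _ => by ring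
  simp only [h1]
  rw [h2, h3, ← Matrix.dotProduct_mulVec, Matrix.mulVec_mulVec, Matrix.mul_nonsing_inv _ hdet,
    Matrix.one_mulVec, dotProduct_comm, ← Matrix.dotProduct_mulVec]

lemma sum_inv_mul_bilForm_single (hA : A.PosDef) :
    ∑ i, ∑ j, A⁻¹ i j * bilForm A ((Pi.single i 1, 0) : Base N) (Pi.single j 1, 0) = N := by
  have hdet : IsUnit A.det := hA.det_pos.ne'.isUnit
  have h1 (i j : Fin N) : bilForm A ((Pi.single i 1, 0) : Base N) (Pi.single j 1, 0) = A j i := by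
    rw [bilForm_symm hA]
    simp [bilForm, Pi.single_apply]
  have h2 : Matrix.trace (A⁻¹ * A) = N := by
    rw [Matrix.nonsing_inv_mul _ hdet, Matrix.trace_one, Fintype.card_fin]
  rw [← h2, Matrix.trace]
  simp only [h1, Matrix.diag_apply, Matrix.mul_apply]

/-- The trace of the metric is N + 2. The bracket in the Hessian therefore traces to (N + 2)|p|_A² -
(N + 2)(|p|_A² + e) = -(N + 2) e. The kernel is harmonic off the origin for e = 0, and for e > 0 its
Laplacian is a negative bump when N > 0. -/
lemma laplacian_newtonKernel (hA : A.PosDef) {e : ℝ} {p : Base N} (hp : 0 < quadForm A p + e) :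
    laplacian A (newtonKernel A e) p =
      -(N * (N + 2)) * e * (quadForm A p + e) ^ (-(N / 2 : ℝ) - 2) := by
  have hdet := hA.det_pos.ne'
  have hd (i j : Fin N) := fderiv_fderiv_newtonKernel hA hp (Pi.single j 1, 0) (Pi.single i 1, 0)
  have hr := fderiv_fderiv_newtonKernel hA hp (0, 1) (0, 1)
  have hi := fderiv_fderiv_newtonKernel hA hp (0, Complex.I) (0, Complex.I)
  change ∀ i j, dMu i (dMu j (newtonKernel A e)) p = _ at hd
  change dReEta (dReEta (newtonKernel A e)) p = _ at hr
  change dImEta (dImEta (newtonKernel A e)) p = _ at hi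
  simp only [laplacian, dEtaEtaBar, hd, hr, hi]
  have h1 (c : ℝ) : ∑ i, ∑ j, A⁻¹ i j * (c *
      ((N + 2) * (bilForm A p (Pi.single j 1, 0) * bilForm A p (Pi.single i 1, 0)) -
        (quadForm A p + e) * bilForm A ((Pi.single i 1, 0) : Base N) (Pi.single j 1, 0))) =
      c * ((N + 2) * (∑ i, ∑ j, A i j * p.1 i * p.1 j) - (quadForm A p + e) * N) := by
    rw [← sum_inv_mul_bilForm hA p, ← sum_inv_mul_bilForm_single hA]
    simp only [Finset.mul_sum, mul_sub, ← Finset.sum_sub_distrib]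
    exact Finset.sum_congr rfl fun i _ => Finset.sum_congr rfl fun j _ => by ring
  rw [h1]
  have h2 : quadForm A p =
      (∑ i, ∑ j, A i j * p.1 i * p.1 j) + A.det * (p.2.re ^ 2 + p.2.im ^ 2) := by
    rw [quadForm, ← Complex.normSq_eq_norm_sq, Complex.normSq_apply]; ring
  have h3 : ∑ i, ∑ j, A i j * p.1 i * p.1 j =
    quadForm A p - A.det * (p.2.re ^ 2 + p.2.im ^ 2) := by rw [h2]; ring
  rw [h3]
  generalize quadForm A p = q
  simp [bilForm]
  field_simp
  ring

end Newton

/-! ### The mass of the regularized Laplacian -/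

section Mass

variable {N : ℕ} {A : Matrix (Fin N) (Fin N) ℝ}

instance : (volume : Measure (Base N)).IsAddHaarMeasure :=
  inferInstanceAs ((volume : Measure (Fin N → ℝ)).prod (volume : Measure ℂ)).IsAddHaarMeasure

lemma finrank_base : Module.finrank ℝ (Base N) = N + 2 := by
  simp [Module.finrank_prod, Complex.finrank_real_complex]

open scoped MatrixOrder Matrix.Norms.L2Operator in
lemma exists_eq_conjTranspose_mul_self (hA : A.PosDef) :
    ∃ B : Matrix (Fin N) (Fin N) ℝ, A = B.conjTranspose * B :=
  CStarAlgebra.nonneg_iff_eq_star_mul_self.mp hA.posSemidef.nonneg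

/-- The Euclidean space `ℝ^N × ℂ`. -/
abbrev EuclideanBase (N : ℕ) : Type := WithLp 2 (EuclideanSpace ℝ (Fin N) × ℂ)

/-- A linear map from `ℝ^N × ℂ` to Euclidean space that is given by a square root `B` of the matrix
and by a scale. -/
def isometryMap (B : Matrix (Fin N) (Fin N) ℝ) (r : ℝ) (p : Base N) : EuclideanBase N :=
  WithLp.toLp 2 (WithLp.toLp 2 (Matrix.toLin' B p.1), r • p.2)

lemma norm_isometryMap_sq {B : Matrix (Fin N) (Fin N) ℝ} (hB : A = B.conjTranspose * B)
    (hdet : 0 ≤ A.det) (p : Base N) : ‖isometryMap B (√A.det) p‖ ^ 2 = quadForm A p := by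
  have h : ∑ i, ∑ j, A i j * p.1 i * p.1 j = ‖WithLp.toLp 2 (Matrix.toLin' B p.1)‖ ^ 2 := by
    have h : ∑ i, ∑ j, A i j * p.1 i * p.1 j = dotProduct p.1 (A.mulVec p.1) := by
      simp only [dotProduct, Matrix.mulVec, Finset.mul_sum]
      exact Finset.sum_congr rfl fun i _ => Finset.sum_congr rfl fun j _ => by ring
    rw [EuclideanSpace.norm_sq_eq, h, hB, ← Matrix.mulVec_mulVec, Matrix.dotProduct_mulVec,
      Matrix.conjTranspose_eq_transpose_of_trivial, Matrix.vecMul_transpose]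
    simp only [dotProduct, Matrix.toLin'_apply, Real.norm_eq_abs, sq_abs]
    exact Finset.sum_congr rfl fun i _ => by ring
  rw [WithLp.prod_norm_sq_eq_of_L2, quadForm, h]
  change _ + ‖√A.det • p.2‖ ^ 2 = _
  rw [norm_smul, mul_pow, Real.norm_eq_abs, sq_abs, Real.sq_sqrt hdet]
  rfl

lemma measurable_isometryMap (B : Matrix (Fin N) (Fin N) ℝ) (r : ℝ) :
    Measurable (isometryMap B r) := by
  have h1 : Continuous (Matrix.toLin' B) := LinearMap.continuous_of_finiteDimensional _
  refine Continuous.measurable ?_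
  unfold isometryMap
  fun_prop

lemma map_isometryMap {B : Matrix (Fin N) (Fin N) ℝ} (hB : B.det ≠ 0) {r : ℝ} (hr : r ≠ 0) :
    (volume : Measure (Base N)).map (isometryMap B r) =
      ENNReal.ofReal (|B.det⁻¹| * |(r ^ 2)⁻¹|) • volume := by
  have h1 := Real.map_matrix_volume_pi_eq_smul_volume_pi hB
  have h2 := Measure.map_addHaar_smul (volume : Measure ℂ) hr
  rw [Complex.finrank_real_complex] at h2
  have hm : Measurable (Matrix.toLin' B) :=
    (LinearMap.continuous_of_finiteDimensional _).measurable
  have h3 : (volume : Measure (Base N)).map (Prod.map (Matrix.toLin' B) fun z : ℂ => r • z) =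
      ENNReal.ofReal (|B.det⁻¹| * |(r ^ 2)⁻¹|) • volume := by
    rw [Measure.volume_eq_prod, ← Measure.map_prod_map _ _ hm (measurable_const_smul r), h1, h2,
      Measure.prod_smul_left, Measure.prod_smul_right, smul_smul,
      ENNReal.ofReal_mul (abs_nonneg _)]
  have e1 : MeasurePreserving (fun p : Base N => ((WithLp.toLp 2 p.1, p.2) :
      EuclideanSpace ℝ (Fin N) × ℂ)) volume volume :=
    (PiLp.volume_preserving_toLp (Fin N)).prod (MeasurePreserving.id volume)
  have e2 := (WithLp.volume_preserving_toLp (EuclideanSpace ℝ (Fin N)) ℂ).comp e1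
  have h4 : isometryMap B r = (WithLp.toLp 2 ∘ fun p : Base N => ((WithLp.toLp 2 p.1, p.2) :
      EuclideanSpace ℝ (Fin N) × ℂ)) ∘ Prod.map (Matrix.toLin' B) fun z : ℂ => r • z := rfl
  rw [h4, ← Measure.map_map e2.measurable (hm.prodMap (measurable_const_smul r)), h3,
    Measure.map_smul, e2.map_eq]

lemma finrank_euclideanBase : Module.finrank ℝ (EuclideanBase N) = N + 2 := by
  rw [(WithLp.linearEquiv 2 ℝ (EuclideanSpace ℝ (Fin N) × ℂ)).finrank_eq]
  simp [Module.finrank_prod, Complex.finrank_real_complex]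

lemma volume_ball_euclideanBase :
    volume.real (Metric.ball (0 : EuclideanBase N) 1) = unitBallVolume (N + 2) := by
  set b := (stdOrthonormalBasis ℝ (EuclideanBase N)).reindex (finCongr finrank_euclideanBase)
  rw [unitBallVolume, Measure.real,
    ← b.measurePreserving_repr.measure_preimage measurableSet_ball.nullMeasurableSet]
  congr 2
  ext x
  simp

/-- Integrals of functions of `|p|_A`. -/
lemma integral_quadForm (hA : A.PosDef) (g : ℝ → ℝ) (hg : Continuous g) :
    (∫ p, g (quadForm A p)) = (volDensity A)⁻¹ * ((N + 2) * unitBallVolume (N + 2) *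
      ∫ y in Set.Ioi (0 : ℝ), y ^ (N + 1) * g (y ^ 2)) ∧
    (IntegrableOn (fun y : ℝ => y ^ (N + 1) * g (y ^ 2)) (Set.Ioi 0) →
      Integrable fun p => g (quadForm A p)) := by
  obtain ⟨B, hB⟩ := exists_eq_conjTranspose_mul_self hA
  have hdet := hA.det_pos
  have hdet2 : A.det = B.det ^ 2 := by
    rw [hB, Matrix.det_mul, Matrix.det_conjTranspose, star_trivial, sq]
  have hB0 : B.det ≠ 0 := fun h => by rw [hdet2, h] at hdet; simp at hdet
  have hr : √A.det ≠ 0 := (Real.sqrt_pos.2 hdet).ne'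
  have hmap := map_isometryMap hB0 hr
  -- The factor ℝ^N contributes |det B| = √(det A), and scaling the plane ℂ by √(det A) contributes
  -- det A. Their product is the density (det A)^{3/2}.
  have hc : |B.det⁻¹| * |(√A.det ^ 2)⁻¹| = (volDensity A)⁻¹ := by
    rw [Real.sq_sqrt hdet.le, abs_inv, abs_inv, abs_of_pos hdet, ← mul_inv, volDensity,
      show |B.det| = √A.det by rw [hdet2, Real.sqrt_sq_eq_abs], Real.sqrt_eq_rpow]
    nth_rw 2 [← Real.rpow_one A.det]
    rw [← Real.rpow_add hdet]
    norm_num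
  rw [hc] at hmap
  have hc0 : 0 ≤ (volDensity A)⁻¹ := by unfold volDensity; positivity
  have hc1 : 0 < (volDensity A)⁻¹ := by unfold volDensity; positivity
  have hT := (measurable_isometryMap B (√A.det)).aemeasurable (μ := volume)
  have hq (p : Base N) : g (quadForm A p) = g (‖isometryMap B (√A.det) p‖ ^ 2) := by
    rw [norm_isometryMap_sq hB hdet.le]
  have : Nontrivial (EuclideanBase N) :=
    Module.nontrivial_of_finrank_pos (R := ℝ) (by rw [finrank_euclideanBase]; omega)
  have hcont : Continuous fun w : EuclideanBase N => g (‖w‖ ^ 2) := by fun_prop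
  constructor
  · simp only [hq]
    rw [← integral_map (f := fun w : EuclideanBase N => g (‖w‖ ^ 2)) hT hcont.aestronglyMeasurable,
      hmap, integral_smul_measure, ENNReal.toReal_ofReal hc0,
      integral_fun_norm_addHaar volume fun y => g (y ^ 2), finrank_euclideanBase,
      volume_ball_euclideanBase]
    simp only [smul_eq_mul, nsmul_eq_mul, Nat.cast_add, Nat.cast_ofNat]
    rw [show N + 2 - 1 = N + 1 from rfl]
    ring
  · intro hint
    simp only [hq]
    have h1 : Integrable (fun w : EuclideanBase N => g (‖w‖ ^ 2)) volume := by
      rw [integrable_fun_norm_addHaar volume (f := fun y => g (y ^ 2)), finrank_euclideanBase]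
      exact hint
    have h2 : Integrable (fun w : EuclideanBase N => g (‖w‖ ^ 2))
        (volume.map (isometryMap B (√A.det))) := by
      rw [hmap]
      exact h1.smul_measure ENNReal.ofReal_ne_top
    exact h2.comp_aemeasurable hT

/-- An explicit primitive of the radial density, so that the total mass is the limit 1/(N + 2) of
the primitive at infinity. -/
lemma hasDerivAt_pow_mul_rpow (y : ℝ) :
    HasDerivAt (fun y : ℝ => y ^ (N + 2) * (y ^ 2 + 1) ^ (-(N / 2 : ℝ) - 1) / (N + 2))
      (y ^ (N + 1) * (y ^ 2 + 1) ^ (-(N / 2 : ℝ) - 2)) y := by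
  have hpos : 0 < y ^ 2 + 1 := by positivity
  have h1 : HasDerivAt (fun y : ℝ => y ^ 2 + 1) (2 * y) y := by
    simpa using (hasDerivAt_pow 2 y).add_const 1
  have h2 := (((hasDerivAt_pow (N + 2) y).mul
    (h1.rpow_const (p := -(N / 2 : ℝ) - 1) (Or.inl hpos.ne')))).div_const (N + 2 : ℝ)
  refine h2.congr_deriv ?_
  have h3 : (y ^ 2 + 1) ^ (-(N / 2 : ℝ) - 1) =
      (y ^ 2 + 1) * (y ^ 2 + 1) ^ (-(N / 2 : ℝ) - 2) := by
    rw [← Real.rpow_one_add' hpos.le]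
    · congr 1; ring
    · have : (0 : ℝ) ≤ N := by positivity
      intro h
      linarith
  rw [show -(N / 2 : ℝ) - 1 - 1 = -(N / 2 : ℝ) - 2 by ring, h3, show N + 2 - 1 = N + 1 from rfl]
  have : (N + 2 : ℝ) ≠ 0 := by positivity
  push_cast
  field_simp
  ring

lemma tendsto_pow_mul_rpow :
    Filter.Tendsto (fun y : ℝ => y ^ (N + 2) * (y ^ 2 + 1) ^ (-(N / 2 : ℝ) - 1) / (N + 2))
      Filter.atTop (nhds (1 / (N + 2 : ℝ))) := by
  refine Filter.Tendsto.div_const ?_ _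
  have h1 : Filter.Tendsto (fun y : ℝ => (1 + (y ^ 2)⁻¹) ^ (-(N / 2 : ℝ) - 1)) Filter.atTop
      (nhds ((1 + 0) ^ (-(N / 2 : ℝ) - 1))) := by
    refine Filter.Tendsto.rpow_const ?_ (Or.inl (by norm_num))
    exact tendsto_const_nhds.add
      (tendsto_inv_atTop_zero.comp (Filter.tendsto_pow_atTop two_ne_zero))
  rw [add_zero, Real.one_rpow] at h1
  refine h1.congr' ?_
  filter_upwards [Filter.eventually_gt_atTop 0] with y hy
  have h2 : y ^ 2 + 1 = y ^ 2 * (1 + (y ^ 2)⁻¹) := by field_simp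
  rw [h2, Real.mul_rpow (by positivity) (by positivity), ← mul_assoc]
  have h3 : y ^ (N + 2) * (y ^ 2) ^ (-(N / 2 : ℝ) - 1) = 1 := by
    rw [← Real.rpow_natCast y (N + 2), ← Real.rpow_natCast y 2, ← Real.rpow_mul hy.le,
      ← Real.rpow_add hy]
    convert Real.rpow_zero y using 2
    push_cast
    ring
  rw [h3, one_mul]

lemma integral_pow_mul_rpow :
    IntegrableOn (fun y : ℝ => y ^ (N + 1) * (y ^ 2 + 1) ^ (-(N / 2 : ℝ) - 2)) (Set.Ioi 0) ∧
    (∫ y in Set.Ioi (0 : ℝ), y ^ (N + 1) * (y ^ 2 + 1) ^ (-(N / 2 : ℝ) - 2)) = 1 / (N + 2 : ℝ) := by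
  have hpos : ∀ y ∈ Set.Ioi (0 : ℝ), 0 ≤ y ^ (N + 1) * (y ^ 2 + 1) ^ (-(N / 2 : ℝ) - 2) := by
    intro y hy
    have : (0 : ℝ) < y := hy
    positivity
  refine ⟨integrableOn_Ioi_deriv_of_nonneg' (fun y _ => hasDerivAt_pow_mul_rpow y) hpos
    tendsto_pow_mul_rpow, ?_⟩
  rw [integral_Ioi_of_hasDerivAt_of_nonneg' (fun y _ => hasDerivAt_pow_mul_rpow y) hpos
    tendsto_pow_mul_rpow]
  simp

/-- `integral_quadForm` asks for a function that is continuous on all of ℝ. The absolute value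
provides this and changes nothing on the nonnegative values of the quadratic form. -/
lemma continuous_abs_add_one_rpow (s : ℝ) : Continuous fun q : ℝ => (|q| + 1) ^ s :=
  (continuous_abs.add continuous_const).rpow_const fun q =>
    Or.inl (by positivity : |q| + 1 ≠ 0)

lemma integrable_regularized (hA : A.PosDef) :
    Integrable fun p => (quadForm A p + 1) ^ (-(N / 2 : ℝ) - 2) := by
  have h := (integral_quadForm hA _ (continuous_abs_add_one_rpow (-(N / 2 : ℝ) - 2))).2 (by
    simpa only [abs_sq] using integral_pow_mul_rpow.1)
  simpa only [abs_of_nonneg (quadForm_nonneg hA _)] using h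

lemma integral_regularized (hA : A.PosDef) :
    (∫ p, (quadForm A p + 1) ^ (-(N / 2 : ℝ) - 2)) =
      (volDensity A)⁻¹ * unitBallVolume (N + 2) := by
  have h := (integral_quadForm hA _ (continuous_abs_add_one_rpow (-(N / 2 : ℝ) - 2))).1
  simp only [abs_sq, abs_of_nonneg (quadForm_nonneg hA _)] at h
  have : (N + 2 : ℝ) ≠ 0 := by positivity
  rw [h, integral_pow_mul_rpow.2]
  field_simp

end Mass

/-! ### Test functions -/

section TestFunctions

variable {N : ℕ} {A : Matrix (Fin N) (Fin N) ℝ} {f g : Base N → ℝ}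

namespace IsTestFunction

lemma fderiv_apply (hf : IsTestFunction f) (v : Base N) :
    IsTestFunction (fun p => fderiv ℝ f p v) :=
  ⟨(hf.1.fderiv_right (m := ∞) (by simp)).clm_apply contDiff_const, hf.2.fderiv_apply (𝕜 := ℝ) v⟩

lemma add (hf : IsTestFunction f) (hg : IsTestFunction g) :
    IsTestFunction (fun p => f p + g p) := ⟨hf.1.add hg.1, hf.2.add hg.2⟩

lemma const_mul (hf : IsTestFunction f) (c : ℝ) : IsTestFunction (fun p => c * f p) :=
  ⟨contDiff_const.mul hf.1, hf.2.mul_left (f := fun _ => c)⟩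

lemma sum {ι : Type} (s : Finset ι) {F : ι → Base N → ℝ} (hF : ∀ i, IsTestFunction (F i)) :
    IsTestFunction (fun p => ∑ i ∈ s, F i p) := by
  classical
  induction s using Finset.induction_on with
  | empty => exact ⟨by simpa using contDiff_const, by
      simp only [Finset.sum_empty]
      exact HasCompactSupport.zero⟩
  | insert a s ha ih =>
    simp only [Finset.sum_insert ha]
    exact (hF a).add ih

lemma dMu (hf : IsTestFunction f) (k : Fin N) : IsTestFunction (dMu k f) := hf.fderiv_apply _

lemma dEtaEtaBar (hf : IsTestFunction f) : IsTestFunction (dEtaEtaBar f) :=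
  (((hf.fderiv_apply _).fderiv_apply _).add ((hf.fderiv_apply _).fderiv_apply _)).const_mul _

lemma laplacian (hf : IsTestFunction f) : IsTestFunction (laplacian A f) :=
  (sum _ fun i => sum _ fun j => ((hf.dMu j).dMu i).const_mul _).add (hf.dEtaEtaBar.const_mul _)

lemma comp_add_right (hf : IsTestFunction f) (x : Base N) : IsTestFunction (fun p => f (p + x)) :=
  ⟨hf.1.comp (contDiff_id.add contDiff_const), hf.2.comp_homeomorph (Homeomorph.addRight x)⟩

lemma integrable_mul (hf : IsTestFunction f) (hg : LocallyIntegrable g) :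
    Integrable (fun p => g p * f p) := by
  simpa [mul_comm] using hg.integrable_smul_left_of_hasCompactSupport hf.1.continuous hf.2

end IsTestFunction

lemma fderiv_fderiv_comm {p : Base N} (hf : ContDiffAt ℝ ∞ f p) (v w : Base N) :
    fderiv ℝ (fun q => fderiv ℝ f q v) p w = fderiv ℝ (fun q => fderiv ℝ f q w) p v := by
  have h := hf.isSymmSndFDerivAt (by
    rw [minSmoothness_of_isRCLikeNormedField]
    exact WithTop.coe_le_coe.2 (le_top : (2 : ℕ∞) ≤ ⊤))
  have hd : DifferentiableAt ℝ (fderiv ℝ f) p :=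
    (hf.fderiv_right (m := ∞) (by simp)).differentiableAt (by simp)
  rw [fderiv_clm_apply hd (differentiableAt_const v),
    fderiv_clm_apply hd (differentiableAt_const w)]
  simpa using h.eq w v

lemma integral_mul_dEtaEtaBar (hg : LocallyIntegrable g) (hf : IsTestFunction f) :
    ∫ p, g p * dEtaEtaBar f p =
      (1 / 4) * ((∫ p, g p * dReEta (dReEta f) p) + ∫ p, g p * dImEta (dImEta f) p) := by
  have h1 : IsTestFunction (dReEta (dReEta f)) := (hf.fderiv_apply _).fderiv_apply _
  have h2 : IsTestFunction (dImEta (dImEta f)) := (hf.fderiv_apply _).fderiv_apply _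
  rw [← integral_add (h1.integrable_mul hg) (h2.integrable_mul hg), ← integral_const_mul]
  exact integral_congr_ae (.of_forall fun p => by simp only [dEtaEtaBar]; ring)

lemma integral_mul_laplacian (hg : LocallyIntegrable g) (hf : IsTestFunction f) :
    ∫ p, g p * laplacian A f p =
      (∑ i, ∑ j, A⁻¹ i j * ∫ p, g p * dMu i (dMu j f) p) +
        4 * (A.det)⁻¹ * ∫ p, g p * dEtaEtaBar f p := by
  have h1 (i j : Fin N) : Integrable fun p => A⁻¹ i j * (g p * dMu i (dMu j f) p) :=
    (((hf.dMu j).dMu i).integrable_mul hg).const_mul _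
  simp only [← integral_const_mul]
  rw [← Finset.sum_congr rfl fun i _ => integral_finsetSum _ fun j _ => h1 i j,
    ← integral_finsetSum _ fun i _ => integrable_finsetSum _ fun j _ => h1 i j,
    ← integral_add (integrable_finsetSum _ fun i _ => integrable_finsetSum _ fun j _ => h1 i j)
      ((hf.dEtaEtaBar.integrable_mul hg).const_mul _)]
  refine integral_congr_ae (.of_forall fun p => ?_)
  simp only [laplacian, mul_add, Finset.mul_sum]
  congr 1
  · exact Finset.sum_congr rfl fun i _ => Finset.sum_congr rfl fun j _ => by ring
  · ring

lemma integral_mul_fderiv_apply (hg : ContDiff ℝ ∞ g) (hf : IsTestFunction f) (v : Base N) :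
    ∫ p, g p * fderiv ℝ f p v = -∫ p, fderiv ℝ g p v * f p := by
  have hg' : Continuous fun p => fderiv ℝ g p v :=
    ((hg.continuous_fderiv (by simp)).clm_apply continuous_const)
  exact integral_mul_fderiv_eq_neg_fderiv_mul_of_integrable
    (hf.integrable_mul hg'.locallyIntegrable)
    ((hf.fderiv_apply v).integrable_mul hg.continuous.locallyIntegrable)
    (hf.integrable_mul hg.continuous.locallyIntegrable)
    (fun p _ => hg.differentiable (by simp) p) (fun p _ => hf.1.differentiable (by simp) p)

lemma integral_mul_fderiv_fderiv_apply (hg : ContDiff ℝ ∞ g) (hf : IsTestFunction f)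
    (v w : Base N) : ∫ p, g p * fderiv ℝ (fun q => fderiv ℝ f q v) p w =
      ∫ p, fderiv ℝ (fun q => fderiv ℝ g q v) p w * f p := by
  have hg' : ContDiff ℝ ∞ fun p => fderiv ℝ g p w :=
    (hg.fderiv_right (m := ∞) (by simp)).clm_apply contDiff_const
  rw [integral_mul_fderiv_apply hg (hf.fderiv_apply v), integral_mul_fderiv_apply hg' hf, neg_neg]
  simp only [fderiv_fderiv_comm hg.contDiffAt]

lemma integral_mul_laplacian_eq (hg : ContDiff ℝ ∞ g) (hf : IsTestFunction f) :
    ∫ p, g p * laplacian A f p = ∫ p, laplacian A g p * f p := by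
  have hc (v w : Base N) : Continuous fun p => fderiv ℝ (fun q => fderiv ℝ g q v) p w :=
    (((((hg.fderiv_right (m := ∞) (by simp)).clm_apply contDiff_const).fderiv_right (m := ∞)
      (by simp)).clm_apply contDiff_const).continuous)
  have hint (v w : Base N) : Integrable fun p => fderiv ℝ (fun q => fderiv ℝ g q v) p w * f p :=
    hf.integrable_mul (hc v w).locallyIntegrable
  rw [integral_mul_laplacian hg.continuous.locallyIntegrable hf,
    integral_mul_dEtaEtaBar hg.continuous.locallyIntegrable hf]
  have e1 (i j : Fin N) : ∫ p, g p * dMu i (dMu j f) p = ∫ p, dMu i (dMu j g) p * f p :=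
    integral_mul_fderiv_fderiv_apply hg hf _ _
  have e2 : ∫ p, g p * dReEta (dReEta f) p = ∫ p, dReEta (dReEta g) p * f p :=
    integral_mul_fderiv_fderiv_apply hg hf _ _
  have e3 : ∫ p, g p * dImEta (dImEta f) p = ∫ p, dImEta (dImEta g) p * f p :=
    integral_mul_fderiv_fderiv_apply hg hf _ _
  have h1 (i j : Fin N) : Integrable fun p => A⁻¹ i j * (dMu i (dMu j g) p * f p) :=
    (hint _ _).const_mul _
  have h2 : Integrable fun p => dReEta (dReEta g) p * f p := hint _ _
  have h3 : Integrable fun p => dImEta (dImEta g) p * f p := hint _ _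
  have h4 : Integrable fun p =>
      4 * (A.det)⁻¹ * (1 / 4 * (dReEta (dReEta g) p * f p + dImEta (dImEta g) p * f p)) :=
    ((h2.add h3).const_mul _).const_mul _
  simp only [e1, e2, e3]
  rw [← integral_add h2 h3]
  simp only [← integral_const_mul]
  rw [← Finset.sum_congr rfl fun i _ => integral_finsetSum _ fun j _ => h1 i j,
    ← integral_finsetSum _ fun i _ => integrable_finsetSum _ fun j _ => h1 i j,
    ← integral_add (integrable_finsetSum _ fun i _ => integrable_finsetSum _ fun j _ => h1 i j)
      h4]
  refine integral_congr_ae (.of_forall fun p => ?_)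
  simp only [laplacian, dEtaEtaBar, add_mul, Finset.sum_mul]
  congr 1
  · exact Finset.sum_congr rfl fun i _ => Finset.sum_congr rfl fun j _ => by ring
  · ring

end TestFunctions

/-! ### The fundamental solution -/

section Fundamental

variable {N : ℕ} {A : Matrix (Fin N) (Fin N) ℝ} {f g : Base N → ℝ}

/-- In polar coordinates the bound becomes r^{n - 1 - d} with n the dimension, and this exponent is
nonnegative because d < n. -/
lemma IsHomKernel.locallyIntegrable {E : Type} [NormedAddCommGroup E] [NormedSpace ℝ E]
    [FiniteDimensional ℝ E] [MeasurableSpace E] [BorelSpace E] {μ : Measure E}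
    [μ.IsAddHaarMeasure] {d : ℕ} {Φ : E → ℝ} (h : IsHomKernel d Φ) (hm : Measurable Φ)
    (hd : d < Module.finrank ℝ E) : LocallyIntegrable Φ μ := by
  have hnt : Nontrivial E := Module.nontrivial_of_finrank_pos (R := ℝ) (by omega)
  obtain ⟨C, hC, hb⟩ := h.exists_bound
  rw [locallyIntegrable_iff]
  intro k hk
  obtain ⟨R, hR⟩ := hk.isBounded.subset_ball (0 : E)
  refine IntegrableOn.mono_set ?_ hR
  have h1 : Integrable (fun x : E => (Set.Iio R).indicator (fun r : ℝ => C * (r ^ d)⁻¹) ‖x‖) μ := by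
    rw [integrable_fun_norm_addHaar]
    have h2 : IntegrableOn (fun y : ℝ => C * y ^ (Module.finrank ℝ E - 1 - d)) (Set.Ioo 0 R) :=
      (Continuous.integrableOn_Icc (by fun_prop)).mono_set Set.Ioo_subset_Icc_self
    have h3 : IntegrableOn (Set.indicator (Set.Iio R)
        fun y : ℝ => C * y ^ (Module.finrank ℝ E - 1 - d)) (Set.Ioi 0) := by
      rw [integrableOn_indicator_iff measurableSet_Iio]
      rwa [Set.inter_comm, Set.Ioi_inter_Iio]
    refine h3.congr_fun (fun y hy => ?_) measurableSet_Ioi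
    have hy' : (0 : ℝ) < y := hy
    by_cases hyR : y < R
    · simp only [Set.indicator_of_mem (Set.mem_Iio.2 hyR), smul_eq_mul]
      rw [pow_sub₀ _ hy'.ne' (by omega)]
      ring
    · simp [Set.indicator_of_notMem (fun h => hyR (Set.mem_Iio.1 h))]
  refine (h1.integrableOn (s := Metric.ball 0 R)).mono' hm.aestronglyMeasurable ?_
  have hne : ∀ᵐ x ∂μ.restrict (Metric.ball 0 R), x ≠ 0 :=
    ae_restrict_of_ae (compl_mem_ae_iff.2 (measure_singleton 0))
  filter_upwards [ae_restrict_mem measurableSet_ball, hne] with x hx hx0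
  rw [Set.indicator_of_mem (by simpa using hx)]
  exact hb x hx0

lemma measurable_newtonKernel (e : ℝ) : Measurable (newtonKernel A e) :=
  ((contDiff_quadForm (n := 0)).continuous.measurable.add_const e).pow_const _

lemma locallyIntegrable_newtonKernel (hA : A.PosDef) : LocallyIntegrable (newtonKernel A 0) :=
  (isHomKernel_newtonKernel hA).locallyIntegrable (measurable_newtonKernel 0)
    (by rw [finrank_base]; omega)

lemma newtonKernel_nonneg (hA : A.PosDef) {e : ℝ} (he : 0 ≤ e) (p : Base N) :
    0 ≤ newtonKernel A e p :=
  Real.rpow_nonneg (add_nonneg (quadForm_nonneg hA p) he) _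

/-- The regularized kernels are dominated by the singular one, which is locally integrable. -/
lemma tendsto_integral_newtonKernel (hA : A.PosDef) (hf : IsTestFunction f) :
    Filter.Tendsto (fun ε : ℝ => ∫ p, newtonKernel A (ε ^ 2) p * f p) (nhdsWithin 0 (Set.Ioi 0))
      (nhds (∫ p, newtonKernel A 0 p * f p)) := by
  have hne : ∀ᵐ p : Base N, p ≠ 0 := compl_mem_ae_iff.2 (measure_singleton 0)
  refine tendsto_integral_filter_of_dominated_convergence (fun p => ‖newtonKernel A 0 p * f p‖)
    (.of_forall fun ε => ((measurable_newtonKernel _).mul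
      hf.1.continuous.measurable).aestronglyMeasurable) ?_
    (hf.integrable_mul (locallyIntegrable_newtonKernel hA)).norm ?_
  · refine .of_forall fun ε => ?_
    filter_upwards [hne] with p hp
    have hq := quadForm_pos hA hp
    rw [norm_mul, norm_mul, Real.norm_of_nonneg (newtonKernel_nonneg hA (sq_nonneg ε) p),
      Real.norm_of_nonneg (newtonKernel_nonneg hA le_rfl p)]
    gcongr
    refine Real.rpow_le_rpow_of_nonpos (by simpa using hq) (by gcongr; positivity) ?_
    have : (0 : ℝ) ≤ N / 2 := by positivity
    linarith
  · filter_upwards [hne] with p hp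
    have hq := quadForm_pos hA hp
    refine Filter.Tendsto.mul_const _ ?_
    refine Filter.Tendsto.rpow_const ?_ (Or.inl (by simpa using hq.ne'))
    refine tendsto_const_nhds.add ?_
    have : Filter.Tendsto (fun ε : ℝ => ε ^ 2) (nhds 0) (nhds (0 ^ 2)) :=
      (continuous_pow 2).tendsto 0
    simp only [ne_eq, OfNat.ofNat_ne_zero, not_false_eq_true, zero_pow] at this
    exact this.mono_left nhdsWithin_le_nhds

/-- The substitution p ↦ εp produces the powers ε^{N+2} · ε² · ε^{-N-4} = 1. The mass of the bump is
thus independent of ε, while its support scale shrinks to the origin. -/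
lemma integral_regularized_mul_eq (hA : A.PosDef) {ε : ℝ} (hε : 0 < ε) :
    ∫ p, ε ^ 2 * (quadForm A p + ε ^ 2) ^ (-(N / 2 : ℝ) - 2) * f p =
      ∫ p, (quadForm A p + 1) ^ (-(N / 2 : ℝ) - 2) * f (ε • p) := by
  have h := Measure.integral_comp_smul (volume : Measure (Base N))
    (fun p => ε ^ 2 * (quadForm A p + ε ^ 2) ^ (-(N / 2 : ℝ) - 2) * f p) ε
  rw [finrank_base, abs_of_pos (by positivity), smul_eq_mul, eq_comm, inv_mul_eq_iff_eq_mul₀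
    (by positivity)] at h
  rw [h, ← integral_const_mul]
  refine integral_congr_ae (.of_forall fun p => ?_)
  have hq := quadForm_nonneg hA p
  simp only [quadForm_smul]
  rw [show ε ^ 2 * quadForm A p + ε ^ 2 = ε ^ 2 * (quadForm A p + 1) by ring,
    Real.mul_rpow (by positivity) (by positivity)]
  have h3 : ε ^ (N + 2) * (ε ^ 2 * (ε ^ 2) ^ (-(N / 2 : ℝ) - 2)) = 1 := by
    rw [← Real.rpow_natCast ε (N + 2), ← Real.rpow_natCast ε 2, ← Real.rpow_mul hε.le,
      ← Real.rpow_add hε, ← Real.rpow_add hε]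
    convert Real.rpow_zero ε using 2
    push_cast
    ring
  linear_combination ((quadForm A p + 1) ^ (-(N / 2 : ℝ) - 2) * f (ε • p)) * h3

lemma tendsto_integral_regularized (hA : A.PosDef) (hf : IsTestFunction f) :
    Filter.Tendsto (fun ε : ℝ => ∫ p, (quadForm A p + 1) ^ (-(N / 2 : ℝ) - 2) * f (ε • p))
      (nhdsWithin 0 (Set.Ioi 0)) (nhds ((volDensity A)⁻¹ * unitBallVolume (N + 2) * f 0)) := by
  obtain ⟨M, hM⟩ := hf.2.exists_bound_of_continuous hf.1.continuous
  rw [← integral_regularized hA, ← integral_mul_const]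
  have hc : Continuous fun p : Base N => (quadForm A p + 1) ^ (-(N / 2 : ℝ) - 2) :=
    ((contDiff_quadForm (n := 0)).continuous.add continuous_const).rpow_const fun p =>
      Or.inl (by linarith [quadForm_nonneg hA p] : 0 < quadForm A p + 1).ne'
  refine tendsto_integral_filter_of_dominated_convergence
    (fun p => (quadForm A p + 1) ^ (-(N / 2 : ℝ) - 2) * M)
    (.of_forall fun ε => ?_) (.of_forall fun ε => .of_forall fun p => ?_)
    ((integrable_regularized hA).mul_const M) (.of_forall fun p => ?_)
  · have := hf.1.continuous
    exact Continuous.aestronglyMeasurable (by fun_prop)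
  · have := quadForm_nonneg hA p
    rw [norm_mul, Real.norm_of_nonneg (by positivity)]
    gcongr
    exact hM _
  · refine Filter.Tendsto.const_mul _ ?_
    have h : Continuous fun ε : ℝ => f (ε • p) := hf.1.continuous.comp (by fun_prop)
    simpa using (h.tendsto 0).mono_left nhdsWithin_le_nhds

/-- The fundamental solution of Δ_A. Integration by parts is applied only to the smooth regularized
kernel, so no boundary term at the singularity arises. Then ε tends to 0 on both sides. -/
theorem integral_newtonKernel_mul_laplacian (hA : A.PosDef) (hf : IsTestFunction f) :
    ∫ p, newtonKernel A 0 p * laplacian A f p =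
      -(N * (N + 2)) * ((volDensity A)⁻¹ * unitBallVolume (N + 2)) * f 0 := by
  refine tendsto_nhds_unique (tendsto_integral_newtonKernel hA (hf.laplacian (A := A))) ?_
  have h := (tendsto_integral_regularized hA hf).const_mul (-(N * (N + 2)) : ℝ)
  rw [← mul_assoc] at h
  refine h.congr' ?_
  filter_upwards [self_mem_nhdsWithin] with ε hε
  have hε' : 0 < ε := hε
  have hpos (p : Base N) : 0 < quadForm A p + ε ^ 2 := by
    have := quadForm_nonneg hA p
    positivity
  have hsmooth : ContDiff ℝ ∞ (newtonKernel A (ε ^ 2)) :=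
    contDiff_iff_contDiffAt.2 fun p => contDiffAt_rpow_quadForm (hpos p) _
  rw [integral_mul_laplacian_eq hsmooth hf, ← integral_regularized_mul_eq hA hε',
    ← integral_const_mul]
  refine integral_congr_ae (.of_forall fun p => ?_)
  simp only [laplacian_newtonKernel hA (hpos p)]
  ring

end Fundamental

/-! ### Convolution with the Newton kernel -/

section Convolution

variable {N : ℕ} {A : Matrix (Fin N) (Fin N) ℝ} {f g : Base N → ℝ}

/-- The convolution of `g` with the Newton kernel. -/
def newtonConv (A : Matrix (Fin N) (Fin N) ℝ) (g : Base N → ℝ) (x : Base N) : ℝ :=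
  ∫ p, newtonKernel A 0 (p - x) * g p

lemma newtonConv_eq (g : Base N → ℝ) (x : Base N) :
    newtonConv A g x = ∫ p, newtonKernel A 0 p * g (p + x) := by
  rw [newtonConv, ← integral_add_right_eq_self _ x]
  simp

/-- The kernel is even. This identification gives smoothness and the passage of derivatives to the
test function. -/
lemma newtonConv_eq_convolution (g : Base N → ℝ) :
    newtonConv A g = convolution (newtonKernel A 0) g (ContinuousLinearMap.lsmul ℝ ℝ) volume := by
  ext x
  rw [newtonConv_eq, convolution, ← integral_neg_eq_self]
  simp only [newtonKernel_neg, ContinuousLinearMap.lsmul_apply, smul_eq_mul]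
  exact integral_congr_ae (.of_forall fun p => by simp only; congr 2; abel)

lemma contDiff_newtonConv (hA : A.PosDef) (hf : IsTestFunction f) :
    ContDiff ℝ ∞ (newtonConv A f) := by
  rw [newtonConv_eq_convolution]
  exact hf.2.contDiff_convolution_right _ (locallyIntegrable_newtonKernel hA) hf.1

lemma fderiv_newtonConv_apply (hA : A.PosDef) (hf : IsTestFunction f) (x v : Base N) :
    fderiv ℝ (newtonConv A f) x v = newtonConv A (fun p => fderiv ℝ f p v) x := by
  have hK := locallyIntegrable_newtonKernel hA
  have hf1 : ContDiff ℝ 1 f := hf.1.of_le (by simp)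
  rw [newtonConv_eq_convolution, newtonConv_eq_convolution,
    (hf.2.hasFDerivAt_convolution_right _ hK hf1 x).fderiv]
  exact convolution_precompR_apply _ hK (hf.2.fderiv ℝ) (hf1.continuous_fderiv one_ne_zero) x v

lemma fderiv_translate (h : Base N → ℝ) (x p v : Base N) :
    fderiv ℝ (fun q => h (q + x)) p v = fderiv ℝ h (p + x) v := by
  rw [fderiv_comp_add_right]

lemma laplacian_translate (f : Base N → ℝ) (x p : Base N) :
    laplacian A (fun q => f (q + x)) p = laplacian A f (p + x) := by
  have h (v w : Base N) : fderiv ℝ (fun r => fderiv ℝ (fun q => f (q + x)) r v) p w =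
      fderiv ℝ (fun r => fderiv ℝ f r v) (p + x) w := by
    simp only [fderiv_translate f]
    exact fderiv_translate (fun r => fderiv ℝ f r v) x p w
  have h1 (i j : Fin N) : dMu i (dMu j fun q => f (q + x)) p = dMu i (dMu j f) (p + x) := h _ _
  have h2 : dReEta (dReEta fun q => f (q + x)) p = dReEta (dReEta f) (p + x) := h _ _
  have h3 : dImEta (dImEta fun q => f (q + x)) p = dImEta (dImEta f) (p + x) := h _ _
  simp only [laplacian, dEtaEtaBar, h1, h2, h3]

lemma newtonConv_laplacian (hA : A.PosDef) (hf : IsTestFunction f) (x : Base N) :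
    newtonConv A (laplacian A f) x =
      -(N * (N + 2)) * ((volDensity A)⁻¹ * unitBallVolume (N + 2)) * f x := by
  have h := integral_newtonKernel_mul_laplacian hA (hf.comp_add_right x)
  simp only [laplacian_translate, zero_add] at h
  rw [newtonConv_eq, h]

/-- Bounded measurable functions with bounded support. -/
def IsTame (g : Base N → ℝ) : Prop :=
  Measurable g ∧ ∃ M R : ℝ, 0 ≤ M ∧ 0 ≤ R ∧ (∀ p, ‖g p‖ ≤ M) ∧ ∀ p, R < ‖p‖ → g p = 0

lemma IsTestFunction.isTame (hf : IsTestFunction f) : IsTame f := by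
  obtain ⟨M, hM⟩ := hf.2.exists_bound_of_continuous hf.1.continuous
  obtain ⟨R, hR⟩ := hf.2.isCompact.isBounded.exists_norm_le
  refine ⟨hf.1.continuous.measurable, max M 0, max R 0, le_max_right _ _, le_max_right _ _,
    fun p => (hM p).trans (le_max_left _ _), fun p hp => ?_⟩
  by_contra h
  exact absurd (hR p (subset_tsupport f h)) (not_le.2 ((le_max_left _ _).trans_lt hp))

lemma IsTame.integrable (hg : IsTame g) : Integrable g := by
  obtain ⟨hm, M, R, hM0, hR0, hM, hR⟩ := hg
  have h : IntegrableOn g (Metric.closedBall 0 R) :=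
    Measure.integrableOn_of_bounded measure_closedBall_lt_top.ne hm.aestronglyMeasurable
      (.of_forall hM)
  rw [integrableOn_iff_integrable_of_support_subset] at h
  · exact h
  · intro p hp
    rw [mem_closedBall_zero_iff]
    by_contra hlt
    exact hp (hR p (not_le.1 hlt))

lemma IsTame.integrable_mul (hA : A.PosDef) (hg : IsTame g) (x : Base N) :
    Integrable fun p => newtonKernel A 0 (p - x) * g p := by
  obtain ⟨hm, M, R, hM0, hR0, hM, hR⟩ := hg
  have hk : Integrable ((Metric.closedBall 0 (R + ‖x‖)).indicator (newtonKernel A 0)) :=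
    (integrable_indicator_iff measurableSet_closedBall).2
      ((locallyIntegrable_newtonKernel hA).integrableOn_isCompact (isCompact_closedBall 0 _))
  refine ((hk.comp_sub_right x).mul_bdd hm.aestronglyMeasurable (.of_forall hM)).congr
    (.of_forall fun p => ?_)
  by_cases hp : R < ‖p‖
  · simp [hR p hp]
  · have h : p - x ∈ Metric.closedBall (0 : Base N) (R + ‖x‖) := by
      rw [mem_closedBall_zero_iff]
      linarith [norm_sub_le p x, not_lt.1 hp]
    simp only [Set.indicator_of_mem h]

/-- On the support of g the weight 1 + ‖x‖ is at most (1 + R)(1 + ‖p - x‖), so it can be moved onto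
the kernel. The weighted kernel is bounded by its integrable singular part near the origin plus a
constant. The norm stands inside the integral because Fubini's theorem needs absolute convergence.
-/
lemma exists_integral_norm_le (hA : A.PosDef) (hg : IsTame g) :
    ∃ C, 0 ≤ C ∧ ∀ x, ∫ p, ‖newtonKernel A 0 (p - x) * g p‖ ≤ C * ((1 + ‖x‖) ^ N)⁻¹ := by
  have hgi := hg.integrable
  have hgm := hg.integrable_mul hA
  obtain ⟨hm, M, R, hM0, hR0, hM, hR⟩ := hg
  obtain ⟨C, hC, hb⟩ := (isHomKernel_newtonKernel hA).exists_bound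
  set k : Base N → ℝ := (Metric.closedBall 0 1).indicator (newtonKernel A 0) with hk
  have hki : Integrable k := (integrable_indicator_iff measurableSet_closedBall).2
    ((locallyIntegrable_newtonKernel hA).integrableOn_isCompact (isCompact_closedBall 0 1))
  have hk0 (p) : 0 ≤ k p := Set.indicator_nonneg (fun p _ => newtonKernel_nonneg hA le_rfl p) p
  have hK (p : Base N) : (1 + ‖p‖) ^ N * newtonKernel A 0 p ≤ 2 ^ N * (k p + C) := by
    have hKp := newtonKernel_nonneg hA le_rfl p
    by_cases hp : ‖p‖ ≤ 1
    · rw [hk, Set.indicator_of_mem (by simpa using hp)]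
      have : (1 + ‖p‖) ^ N ≤ 2 ^ N := by gcongr; linarith
      calc _ ≤ 2 ^ N * newtonKernel A 0 p := by gcongr
        _ ≤ _ := by gcongr; linarith
    · push Not at hp
      have hp0 : p ≠ 0 := norm_pos_iff.1 (by linarith)
      have h1 := hb p hp0
      rw [Real.norm_of_nonneg hKp] at h1
      calc (1 + ‖p‖) ^ N * newtonKernel A 0 p ≤ (2 * ‖p‖) ^ N * (C * (‖p‖ ^ N)⁻¹) := by
            gcongr; linarith
        _ = 2 ^ N * C := by
            rw [mul_pow]
            have : ‖p‖ ^ N ≠ 0 := by positivity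
            field_simp
        _ ≤ _ := by gcongr; linarith [hk0 p]
  set D : ℝ := (1 + R) ^ N * 2 ^ N * (M * (∫ p, k p) + C * ∫ p, ‖g p‖)
  refine ⟨D, ?_, fun x => ?_⟩
  · have : 0 ≤ ∫ p, k p := integral_nonneg hk0
    have : 0 ≤ ∫ p, ‖g p‖ := integral_nonneg fun p => norm_nonneg _
    positivity
  have hpt (p : Base N) : ‖newtonKernel A 0 (p - x) * g p‖ ≤ ((1 + ‖x‖) ^ N)⁻¹ *
      ((1 + R) ^ N * 2 ^ N * (M * k (p - x) + C * ‖g p‖)) := by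
    by_cases hp : R < ‖p‖
    · rw [hR p hp, mul_zero, norm_zero]
      have := hk0 (p - x)
      positivity
    · have hKp := newtonKernel_nonneg hA le_rfl (p - x)
      rw [norm_mul, Real.norm_of_nonneg hKp, ← div_eq_inv_mul, le_div_iff₀ (by positivity)]
      have h1 : 1 + ‖x‖ ≤ (1 + R) * (1 + ‖p - x‖) := by
        have h2 : ‖x‖ ≤ ‖p‖ + ‖p - x‖ := by
          have := norm_sub_le p (p - x)
          rwa [sub_sub_cancel] at this
        nlinarith [norm_nonneg (p - x)]
      calc newtonKernel A 0 (p - x) * ‖g p‖ * (1 + ‖x‖) ^ N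
          ≤ newtonKernel A 0 (p - x) * ‖g p‖ * ((1 + R) * (1 + ‖p - x‖)) ^ N := by gcongr
        _ = (1 + R) ^ N * ‖g p‖ * ((1 + ‖p - x‖) ^ N * newtonKernel A 0 (p - x)) := by
            rw [mul_pow]; ring
        _ ≤ (1 + R) ^ N * ‖g p‖ * (2 ^ N * (k (p - x) + C)) :=
            mul_le_mul_of_nonneg_left (hK _) (by positivity)
        _ = (1 + R) ^ N * 2 ^ N * (‖g p‖ * k (p - x) + C * ‖g p‖) := by ring
        _ ≤ _ := by
            have := hk0 (p - x)
            gcongr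
            exact hM p
  have hi : Integrable fun p => ((1 + ‖x‖) ^ N)⁻¹ *
      ((1 + R) ^ N * 2 ^ N * (M * k (p - x) + C * ‖g p‖)) :=
    ((((hki.comp_sub_right x).const_mul M).add (hgi.norm.const_mul C)).const_mul _).const_mul _
  refine (integral_mono (hgm x).norm hi hpt).trans_eq ?_
  rw [integral_const_mul, integral_const_mul,
    integral_add ((hki.comp_sub_right x).const_mul M) (hgi.norm.const_mul C), integral_const_mul,
    integral_const_mul, integral_sub_right_eq_self k x]
  ring

variable {X : Type} [MeasurableSpace X] {S : Set (Base N)} {ν : Measure X} {L : X → Base N}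

/-- The integral over p decays like (1 + ‖L u‖)^{-N}, which is what a source integrates. -/
lemma IsSource.integrable_prod [SFinite ν] (hs : IsSource N S ν L) (hA : A.PosDef)
    (hg : IsTame g) :
    Integrable (fun z : Base N × X => newtonKernel A 0 (z.1 - L z.2) * g z.1)
      (volume.prod ν) := by
  have hmeas : Measurable fun z : Base N × X => newtonKernel A 0 (z.1 - L z.2) * g z.1 :=
    ((measurable_newtonKernel 0).comp (measurable_fst.sub (hs.meas.comp measurable_snd))).mul
      (hg.1.comp measurable_fst)
  obtain ⟨C, hC, hb⟩ := exists_integral_norm_le hA hg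
  refine (integrable_prod_iff' hmeas.aestronglyMeasurable).2
    ⟨.of_forall fun u => hg.integrable_mul hA (L u), ?_⟩
  refine (hs.int.const_mul C).mono' ?_ (.of_forall fun u => ?_)
  · have h := (hmeas.norm.comp measurable_swap).stronglyMeasurable.integral_prod_right' (ν := volume)
    exact h.aestronglyMeasurable
  · rw [Real.norm_of_nonneg (integral_nonneg fun p => norm_nonneg _)]
    exact hb (L u)

lemma IsSource.integral_potential_mul [SFinite ν] (hs : IsSource N S ν L) (hA : A.PosDef)
    (hg : IsTame g) :
    ∫ p, potential ν L (newtonKernel A 0) p * g p = ∫ u, newtonConv A g (L u) ∂ν := by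
  simp only [potential, newtonConv, ← integral_mul_const]
  exact integral_integral_swap (hs.integrable_prod hA hg)

lemma IsSource.integrable_newtonConv [SFinite ν] (hs : IsSource N S ν L) (hA : A.PosDef)
    (hg : IsTame g) : Integrable (fun u => newtonConv A g (L u)) ν :=
  (hs.integrable_prod hA hg).integral_prod_right

lemma IsSource.locallyIntegrable_potential [SFinite ν] (hs : IsSource N S ν L) (hA : A.PosDef) :
    LocallyIntegrable (potential ν L (newtonKernel A 0)) := by
  rw [locallyIntegrable_iff]
  intro k hk
  obtain ⟨R, hR⟩ := hk.isBounded.subset_closedBall (0 : Base N)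
  refine IntegrableOn.mono_set ?_ hR
  -- Testing against the indicator of a ball turns joint integrability into integrability of the
  -- potential on that ball. This is why tame functions need not be continuous.
  have ht : IsTame ((Metric.closedBall (0 : Base N) R).indicator fun _ => (1 : ℝ)) := by
    refine ⟨measurable_const.indicator measurableSet_closedBall, 1, max R 0, zero_le_one,
      le_max_right _ _, fun p => ?_, fun p hp => ?_⟩
    · exact (norm_indicator_le_norm_self _ _).trans (by simp)
    · refine Set.indicator_of_notMem (fun h => ?_) _
      rw [mem_closedBall_zero_iff] at h
      exact absurd h (not_le.2 ((le_max_left _ _).trans_lt hp))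
  have h := (hs.integrable_prod hA ht).integral_prod_left
  simp only [integral_mul_const] at h
  rw [← integrable_indicator_iff measurableSet_closedBall]
  refine h.congr (.of_forall fun p => ?_)
  by_cases hp : p ∈ Metric.closedBall (0 : Base N) R <;> simp [hp, potential]

end Convolution

/-! ### The potentials of the faces -/

section FacePotential

variable {N : ℕ} {A : Matrix (Fin N) (Fin N) ℝ} {f : Base N → ℝ}

/-- The Newton potential of Lebesgue measure on the face `I`. -/
def facePotential (A : Matrix (Fin N) (Fin N) ℝ) (I : Finset (Fin (N + 1))) : Base N → ℝ :=
  potential (faceMeasure I) coneMap (newtonKernel A 0)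

lemma isSource_pair (hN : 1 ≤ N) {a b : Fin (N + 1)} (hab : a ≠ b) :
    IsSource N (discCone a b) (faceMeasure {a, b}) (coneMap : _ → Base N) :=
  isSource_faceMeasure hN hab (by simp) (by simp)

/-- The derivative of the potential of a face in the direction of a ray that is transversal to the
face is the potential of a smaller face. -/
lemma fderiv_facePotential (hN : 1 ≤ N) (hA : A.PosDef) {a b c : Fin (N + 1)} (hab : a ≠ b)
    (hac : a ≠ c) (hbc : b ≠ c) {p : Base N} (hp : p ∉ discCone a b) :
    fderiv ℝ (facePotential A {a, b}) p (rayVec c) = facePotential A (insert c {a, b}) p := by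
  have hs := isSource_pair hN hab
  have hK := isHomKernel_newtonKernel hA
  obtain ⟨ε, hε, C, -, hb⟩ := hs.exists_bound hK le_rfl hp
  have hmem {u : Fin (N + 1) → ℝ} (hu : ∀ k, 0 ≤ u k)
      (hI : ∀ k ∈ ({a, b} : Finset (Fin (N + 1))), u k = 0) : coneMap u ∈ discCone a b :=
    coneMap_mem_discCone hu (hI a (by simp)) (hI b (by simp))
  have hderiv {x : Base N} (hx : x ∈ discCone a b) :
      HasFDerivAt (fun x => newtonKernel A 0 (p - x)) (-fderiv ℝ (newtonKernel A 0) (p - x)) x := by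
    have h1 := (hK.differentiableAt (hb p (Metric.mem_ball_self hε) x hx).1).hasFDerivAt
    have h2 := h1.comp x ((hasFDerivAt_id x).const_sub p)
    rwa [ContinuousLinearMap.comp_neg, ContinuousLinearMap.comp_id] at h2
  have hae : (fun u => fderiv ℝ (fun x => newtonKernel A 0 (p - x)) (coneMap u) (rayVec c))
      =ᵐ[faceMeasure {a, b}] fun u => -fderiv ℝ (newtonKernel A 0) (p - coneMap u) (rayVec c) := by
    filter_upwards [hs.mem] with u hu
    rw [(hderiv hu).fderiv, _root_.neg_apply]
  have hint := hs.integrable (hK.fderiv.clm_apply (rayVec c)) (Nat.le_succ N) hp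
  have h := integral_fderiv_rayVec (G := fun x => newtonKernel A 0 (p - x)) (C := C)
    hN (I := {a, b}) ⟨a, by simp⟩ (c := c) (by simp [hac.symm, hbc.symm])
    (fun u hu hI => ⟨(hderiv (hmem hu hI)).differentiableAt,
      (hb p (Metric.mem_ball_self hε) _ (hmem hu hI)).2⟩)
    (hint.neg.congr hae.symm)
  rw [integral_congr_ae hae, integral_neg, neg_inj] at h
  rw [facePotential, hs.fderiv_apply hK le_rfl hp]
  exact h

/-- The weak form of `fderiv_facePotential`. By Fubini's theorem the derivative falls on the smooth
convolution, and the ray is integrated out there. The derivative of the singular potential is never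
integrated. -/
lemma integral_facePotential_mul_fderiv (hN : 1 ≤ N) (hA : A.PosDef) {a b c : Fin (N + 1)}
    (hab : a ≠ b) (hac : a ≠ c) (hbc : b ≠ c) (hf : IsTestFunction f) :
    ∫ p, facePotential A {a, b} p * fderiv ℝ f p (rayVec c) =
      -∫ u, newtonConv A f (coneMap u) ∂faceMeasure (insert c {a, b}) := by
  have hs := isSource_pair hN hab
  have hv := (hf.fderiv_apply (rayVec c)).isTame
  obtain ⟨C, hC, hb⟩ := exists_integral_norm_le hA hf.isTame
  rw [facePotential, hs.integral_potential_mul hA hv]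
  have hint := hs.integrable_newtonConv hA hv
  simp only [← fderiv_newtonConv_apply hA hf] at hint ⊢
  exact integral_fderiv_rayVec hN ⟨a, by simp⟩ (by simp [hac.symm, hbc.symm])
    (fun u _ _ => ⟨(contDiff_newtonConv hA hf).differentiable (by simp) _,
      (norm_integral_le_integral_norm _).trans (hb _)⟩) hint

lemma integral_facePotential_mul_laplacian (hN : 1 ≤ N) (hA : A.PosDef) {a b : Fin (N + 1)}
    (hab : a ≠ b) (hf : IsTestFunction f) :
    ∫ p, facePotential A {a, b} p * laplacian A f p =
      -(N * (N + 2)) * ((volDensity A)⁻¹ * unitBallVolume (N + 2)) *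
        ∫ u, f (coneMap u) ∂faceMeasure {a, b} := by
  rw [facePotential, (isSource_pair hN hab).integral_potential_mul hA hf.laplacian.isTame]
  simp only [newtonConv_laplacian hA hf]
  rw [integral_const_mul]

lemma laplacian_facePotential (hN : 1 ≤ N) (hA : A.PosDef) {a b : Fin (N + 1)} (hab : a ≠ b)
    {p : Base N} (hp : p ∉ discCone a b) : laplacian A (facePotential A {a, b}) p = 0 := by
  have hs := isSource_pair hN hab
  have hK := isHomKernel_newtonKernel hA
  have h (v w : Base N) := hs.fderiv_fderiv_apply hK le_rfl hp v w
  have hint (v w : Base N) := hs.integrable ((hK.fderiv.clm_apply v).fderiv.clm_apply w)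
    (show N ≤ N + 1 + 1 by omega) hp
  have h1 (i j : Fin N) : dMu i (dMu j (facePotential A {a, b})) p =
    ∫ u, dMu i (dMu j (newtonKernel A 0)) (p - coneMap u) ∂faceMeasure {a, b} := h _ _
  have h2 : dReEta (dReEta (facePotential A {a, b})) p =
    ∫ u, dReEta (dReEta (newtonKernel A 0)) (p - coneMap u) ∂faceMeasure {a, b} := h _ _
  have h3 : dImEta (dImEta (facePotential A {a, b})) p =
    ∫ u, dImEta (dImEta (newtonKernel A 0)) (p - coneMap u) ∂faceMeasure {a, b} := h _ _
  have i1 (i j : Fin N) : Integrable (fun u => A⁻¹ i j *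
    dMu i (dMu j (newtonKernel A 0)) (p - coneMap u)) (faceMeasure {a, b}) :=
    (hint _ _).const_mul _
  have i2 : Integrable (fun u => dReEta (dReEta (newtonKernel A 0)) (p - coneMap u))
    (faceMeasure {a, b}) := hint _ _
  have i3 : Integrable (fun u => dImEta (dImEta (newtonKernel A 0)) (p - coneMap u))
    (faceMeasure {a, b}) := hint _ _
  have i4 : Integrable (fun u => 4 * (A.det)⁻¹ * (1 / 4 *
      (dReEta (dReEta (newtonKernel A 0)) (p - coneMap u) +
        dImEta (dImEta (newtonKernel A 0)) (p - coneMap u)))) (faceMeasure {a, b}) :=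
    ((i2.add i3).const_mul _).const_mul _
  have h4 : laplacian A (facePotential A {a, b}) p =
      ∫ u, laplacian A (newtonKernel A 0) (p - coneMap u) ∂faceMeasure {a, b} := by
    simp only [laplacian, dEtaEtaBar, h1, h2, h3]
    rw [← integral_add i2 i3]
    simp only [← integral_const_mul]
    rw [← Finset.sum_congr rfl fun i _ => integral_finsetSum _ fun j _ => i1 i j,
      ← integral_finsetSum _ fun i _ => integrable_finsetSum _ fun j _ => i1 i j,
      ← integral_add (integrable_finsetSum _ fun i _ => integrable_finsetSum _ fun j _ => i1 i j)
        i4]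
  rw [h4]
  refine integral_eq_zero_of_ae ?_
  filter_upwards [hs.mem] with u hu
  have hne : p - coneMap u ≠ 0 := fun h0 => hp (sub_eq_zero.1 h0 ▸ hu)
  rw [laplacian_newtonKernel hA (by simpa using quadForm_pos hA hne)]
  simp

end FacePotential

/-! ### The functions `α_{ab}` for `0 ≤ a, b ≤ N` -/

section PairPotential

variable {N : ℕ} {A : Matrix (Fin N) (Fin N) ℝ} {f : Base N → ℝ}

/-- The function `α_{ab}`, for `0 ≤ a, b ≤ N`. -/
def pairPotential (A : Matrix (Fin N) (Fin N) ℝ) (a b : Fin (N + 1)) (p : Base N) : ℝ :=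
  if a = b then 0 else kernelConst A * facePotential A {a, b} p

lemma pairPotential_of_ne {a b : Fin (N + 1)} (hab : a ≠ b) :
    pairPotential A a b = fun p => kernelConst A * facePotential A {a, b} p := by
  ext p; simp [pairPotential, hab]

lemma pairPotential_self (a : Fin (N + 1)) : pairPotential A a a = fun _ => 0 := by
  ext p; simp [pairPotential]

lemma pairPotential_symm (a b : Fin (N + 1)) : pairPotential A a b = pairPotential A b a := by
  ext p; simp only [pairPotential, Finset.pair_comm a b, eq_comm]

lemma measurable_newtonKernel_sub (p : Base N) :
    Measurable fun u : Fin (N + 1) → ℝ => newtonKernel A 0 (p - coneMap u) :=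
  (measurable_newtonKernel 0).comp (measurable_const.sub continuous_coneMap.measurable)

lemma kernel0_eq (hA : A.PosDef) (i : Fin N) (p : Base N) (t : Param0 i) :
    kernel0 A i p t = newtonKernel A 0 (p - tVec0 i t) := one_div_normA_pow hA _

lemma kernel_eq (hA : A.PosDef) (i j : Fin N) (p : Base N) (q : Param i j) :
    kernel A i j p q = newtonKernel A 0 (p - (tVec i j q - q.1 • oneVec N)) := by
  rw [← one_div_normA_pow hA, kernel, sub_sub_eq_add_sub, sub_add_eq_add_sub]

lemma alpha0_eq (hA : A.PosDef) (i : Fin N) : alpha0 A i = pairPotential A 0 i.succ := by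
  ext p
  rw [pairPotential_of_ne (Fin.succ_ne_zero i).symm, alpha0]
  simp only [kernel0_eq hA]
  rw [integral_orthant0 i (g := fun x => newtonKernel A 0 (p - x))
    (measurable_newtonKernel_sub p).aestronglyMeasurable]
  rfl

lemma alphaIntegral_eq (hA : A.PosDef) {i j : Fin N} (hij : i ≠ j) :
    alphaIntegral A i j = pairPotential A i.succ j.succ := by
  ext p
  rw [pairPotential_of_ne (fun h => hij (Fin.succ_injective _ h)), alphaIntegral]
  simp only [kernel_eq hA]
  rw [integral_orthant i j (g := fun x => newtonKernel A 0 (p - x))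
    (measurable_newtonKernel_sub p).aestronglyMeasurable]
  rfl

lemma alpha_eq (hA : A.PosDef) (i j : Fin N) : alpha A i j = pairPotential A i.succ j.succ := by
  ext p
  rw [alpha]
  split_ifs with h1 h2
  · rw [alphaIntegral_eq hA h1.ne]
  · rw [alphaIntegral_eq hA h2.ne, pairPotential_symm]
  · rw [le_antisymm (not_lt.1 h2) (not_lt.1 h1), pairPotential_self]

lemma ansatzV_self (hA : A.PosDef) (i : Fin N) :
    ansatzV A i i = fun p => ∑ b, pairPotential A i.succ b p := by
  ext p
  rw [ansatzV, if_pos rfl, Fin.sum_univ_succ, alpha0_eq hA, pairPotential_symm]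
  simp only [alpha_eq hA]
  congr 1
  rw [Finset.sum_filter]
  refine Finset.sum_congr rfl fun k _ => ?_
  by_cases h : k = i
  · simp [h, pairPotential_self]
  · simp [h]

lemma ansatzV_of_ne (hA : A.PosDef) {i j : Fin N} (hij : i ≠ j) :
    ansatzV A i j = fun p => -pairPotential A i.succ j.succ p := by
  ext p
  rw [ansatzV, if_neg hij, alpha_eq hA]

lemma ansatzV_symm (hA : A.PosDef) (i j : Fin N) : ansatzV A i j = ansatzV A j i := by
  by_cases h : i = j
  · rw [h]
  · rw [ansatzV_of_ne hA h, ansatzV_of_ne hA (Ne.symm h), pairPotential_symm]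

lemma notMem_discCone {p : Base N} (hp : p ∈ (discriminant N)ᶜ) {a b : Fin (N + 1)}
    (hab : a ≠ b) : p ∉ discCone a b := fun h => hp (discCone_subset_discriminant hab h)

lemma contDiffAt_pairPotential (hN : 1 ≤ N) (hA : A.PosDef) {p : Base N}
    (hp : ∀ a b, a ≠ b → p ∉ discCone a b) (a b : Fin (N + 1)) :
    ContDiffAt ℝ ∞ (pairPotential A a b) p := by
  by_cases hab : a = b
  · rw [hab, pairPotential_self]
    exact contDiffAt_const
  · rw [pairPotential_of_ne hab]
    exact contDiffAt_const.mul ((isSource_pair hN hab).contDiffAt (isHomKernel_newtonKernel hA)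
      le_rfl (hp a b hab))

lemma locallyIntegrable_pairPotential (hN : 1 ≤ N) (hA : A.PosDef) (a b : Fin (N + 1)) :
    LocallyIntegrable (pairPotential A a b) := by
  by_cases hab : a = b
  · rw [hab, pairPotential_self]
    exact locallyIntegrable_const 0
  · rw [pairPotential_of_ne hab]
    exact ((isSource_pair hN hab).locallyIntegrable_potential hA).smul (kernelConst A)

lemma sum_rayVec : ∑ c, (rayVec c : Base N) = 0 := by
  rw [Fin.sum_univ_succ, rayVec_zero_eq_neg_sum]
  simp [rayVec_succ]

lemma unitBallVolume_pos (n : ℕ) : 0 < unitBallVolume n :=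
  ENNReal.toReal_pos (Metric.measure_ball_pos volume _ one_pos).ne' measure_ball_lt_top.ne

/-- The normalization of the kernel is chosen to cancel the mass of its Laplacian. -/
lemma kernelConst_mul (hN : 1 ≤ N) : kernelConst A * ((N * (N + 2)) * unitBallVolume (N + 2)) =
    2 * Real.pi * √A.det := by
  have h1 := (unitBallVolume_pos (N + 2)).ne'
  have h2 : (N : ℝ) ≠ 0 := by positivity
  have h3 : (N + 2 : ℝ) ≠ 0 := by positivity
  rw [kernelConst]
  field_simp

lemma integral_pairPotential_mul_laplacian (hN : 1 ≤ N) (hA : A.PosDef) {a b : Fin (N + 1)}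
    (hab : a ≠ b) (hf : IsTestFunction f) :
    ∫ p, pairPotential A a b p * laplacian A f p =
      -(2 * Real.pi * √A.det) * (volDensity A)⁻¹ * ∫ u, f (coneMap u) ∂faceMeasure {a, b} := by
  simp only [pairPotential_of_ne hab, mul_assoc (kernelConst A)]
  rw [integral_const_mul, integral_facePotential_mul_laplacian hN hA hab hf,
    ← kernelConst_mul hN]
  ring

lemma distribLaplacianEq_pairPotential (hN : 1 ≤ N) (hA : A.PosDef) {a b : Fin (N + 1)}
    (hab : a ≠ b) {m : (Base N → ℝ) → ℝ}
    (hm : ∀ f, Continuous f → m f = ∫ u, f (coneMap u) ∂faceMeasure {a, b}) :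
    DistribLaplacianEq A (pairPotential A a b) fun f => -2 * Real.pi * √A.det * m f := by
  refine ⟨locallyIntegrable_pairPotential hN hA a b, fun f hf => ?_⟩
  have hdet := hA.det_pos
  have : volDensity A ≠ 0 := by unfold volDensity; positivity
  simp only [hm f hf.1.continuous]
  rw [integral_mul_const, integral_pairPotential_mul_laplacian hN hA hab hf]
  field_simp

/-- The relations between the first derivatives of the functions `α_{ab}`. Here `d a b c` stands
for the derivative of `α_{ab}` in the direction of the ray `E_c`. -/
structure CommRelations (d : Fin (N + 1) → Fin (N + 1) → Fin (N + 1) → ℝ) : Prop where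
  symm : ∀ a b c, d a b c = d b a c
  self : ∀ a c, d a a c = 0
  comm : ∀ a b c, a ≠ b → a ≠ c → b ≠ c → d a b c = d a c b
  sum_eq_zero : ∀ a b, ∑ c, d a b c = 0

lemma CommRelations.zero_eq {d : Fin (N + 1) → Fin (N + 1) → Fin (N + 1) → ℝ}
    (h : CommRelations d) (a b : Fin N) :
    d a.succ b.succ 0 = -∑ t : Fin N, d a.succ b.succ t.succ := by
  have := h.sum_eq_zero a.succ b.succ
  rw [Fin.sum_univ_succ] at this
  linarith

/-- Exchanging b and c termwise would give the sum of d a c b over all b, which vanishes. The only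
exception is b = a, where the left term is 0 and the right one is d a c a. -/
lemma CommRelations.sum_eq {d : Fin (N + 1) → Fin (N + 1) → Fin (N + 1) → ℝ}
    (h : CommRelations d) {a c : Fin (N + 1)} (hac : a ≠ c) : ∑ b, d a b c = -d a c a := by
  have h1 : ∑ b, d a b c + d a c a = ∑ b, d a c b := by
    rw [← Finset.add_sum_erase _ _ (Finset.mem_univ a),
      ← Finset.add_sum_erase _ (fun b => d a c b) (Finset.mem_univ a), h.self, zero_add, add_comm]
    congr 1
    refine Finset.sum_congr rfl fun b hb => ?_
    by_cases hbc : b = c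
    · rw [hbc]
    · exact h.comm a b c (Finset.ne_of_mem_erase hb).symm hac hbc
  rw [h.sum_eq_zero] at h1
  linarith

/-- For distinct a, b, c the derivative is the potential of the face {a, b, c}, which does not
depend on the order of the indices. The sum relation is linearity of the derivative applied to ∑ E_c
= 0. -/
lemma commRelations_fderiv (hN : 1 ≤ N) (hA : A.PosDef) {p : Base N}
    (hp : ∀ a b, a ≠ b → p ∉ discCone a b) :
    CommRelations fun a b c => fderiv ℝ (pairPotential A a b) p (rayVec c) where
  symm a b c := by rw [pairPotential_symm]
  self a c := by simp [pairPotential_self]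
  comm a b c hab hac hbc := by
    have h (a b c : Fin (N + 1)) (hab : a ≠ b) (hac : a ≠ c) (hbc : b ≠ c) :
        fderiv ℝ (pairPotential A a b) p (rayVec c) =
          kernelConst A * facePotential A (insert c {a, b}) p := by
      have hd : DifferentiableAt ℝ (facePotential A {a, b}) p :=
        ((isSource_pair hN hab).contDiffAt (isHomKernel_newtonKernel hA) le_rfl
          (hp a b hab)).differentiableAt (by simp)
      rw [pairPotential_of_ne hab, fderiv_const_mul hd, _root_.smul_apply,
        fderiv_facePotential hN hA hab hac hbc (hp a b hab), smul_eq_mul]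
    rw [h a b c hab hac hbc, h a c b hac hab hbc.symm, Finset.insert_comm c a,
      Finset.insert_comm b a, Finset.pair_comm b c]
  sum_eq_zero a b := by rw [← map_sum, sum_rayVec, map_zero]

lemma commRelations_integral (hN : 1 ≤ N) (hA : A.PosDef) (hf : IsTestFunction f) :
    CommRelations fun a b c => ∫ p, pairPotential A a b p * fderiv ℝ f p (rayVec c) where
  symm a b c := by rw [pairPotential_symm]
  self a c := by simp [pairPotential_self]
  comm a b c hab hac hbc := by
    have h (a b c : Fin (N + 1)) (hab : a ≠ b) (hac : a ≠ c) (hbc : b ≠ c) :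
        ∫ p, pairPotential A a b p * fderiv ℝ f p (rayVec c) =
          kernelConst A * -∫ u, newtonConv A f (coneMap u) ∂faceMeasure (insert c {a, b}) := by
      simp only [pairPotential_of_ne hab, mul_assoc (kernelConst A)]
      rw [integral_const_mul, integral_facePotential_mul_fderiv hN hA hab hac hbc hf]
    rw [h a b c hab hac hbc, h a c b hac hab hbc.symm, Finset.insert_comm c a,
      Finset.insert_comm b a, Finset.pair_comm b c]
  sum_eq_zero a b := by
    rw [← integral_finsetSum _ fun c _ =>
      (hf.fderiv_apply (rayVec c)).integrable_mul (locallyIntegrable_pairPotential hN hA a b)]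
    simp only [← Finset.mul_sum, ← map_sum, sum_rayVec, map_zero, mul_zero, integral_zero]

/-- Linear functionals that satisfy the relations `CommRelations` are symmetric on the
functions `v_{ij}`. -/
lemma CommRelations.ansatz {d : Fin (N + 1) → Fin (N + 1) → Fin (N + 1) → ℝ}
    (h : CommRelations d) {V : Fin N → Fin N → Fin N → ℝ}
    (hself : ∀ i k, V i i k = ∑ b, d i.succ b k.succ)
    (hne : ∀ i j k, i ≠ j → V i j k = -d i.succ j.succ k.succ) (i j k : Fin N) :
    V i j k = V i k j := by
  have hs {i j : Fin N} (hij : i ≠ j) : i.succ ≠ j.succ := fun h => hij (Fin.succ_injective _ h)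
  by_cases hjk : j = k
  · rw [hjk]
  by_cases hij : i = j
  · subst hij
    rw [hself, hne _ _ _ hjk, h.sum_eq (hs hjk)]
  by_cases hik : i = k
  · subst hik
    rw [hself, hne _ _ _ hij, h.sum_eq (hs hij)]
  · rw [hne _ _ _ hij, hne _ _ _ hik, h.comm _ _ _ (hs hij) (hs hik) (hs hjk)]

end PairPotential

/-! ### Linearity of the differential operators -/

section Linearity

variable {N : ℕ} {A : Matrix (Fin N) (Fin N) ℝ} {f : Base N → ℝ}

lemma fderiv_sum_const_mul {ι : Type} [Fintype ι] {F : ι → Base N → ℝ} {p : Base N}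
    (hF : ∀ i, ContDiffAt ℝ ∞ (F i) p) (c : ι → ℝ) (v : Base N) :
    fderiv ℝ (fun q => ∑ i, c i * F i q) p v = ∑ i, c i * fderiv ℝ (F i) p v := by
  have hd (i) : DifferentiableAt ℝ (F i) p := (hF i).differentiableAt (by simp)
  rw [fderiv_fun_sum fun i _ => (hd i).const_mul (c i), _root_.sum_apply]
  exact Finset.sum_congr rfl fun i _ => by rw [fderiv_const_mul (hd i)]; rfl

lemma eventually_differentiableAt {F : Base N → ℝ} {p : Base N} (hF : ContDiffAt ℝ ∞ F p) :
    ∀ᶠ q in nhds p, DifferentiableAt ℝ F q := by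
  filter_upwards [(hF.of_le (m := 1) (by simp)).eventually (by simp)] with q hq
    using hq.differentiableAt one_ne_zero

lemma contDiffAt_fderiv_apply {F : Base N → ℝ} {p : Base N} (hF : ContDiffAt ℝ ∞ F p)
    (v : Base N) : ContDiffAt ℝ ∞ (fun q => fderiv ℝ F q v) p :=
  (hF.fderiv_right (m := ∞) (by simp)).clm_apply contDiffAt_const

lemma fderiv_fderiv_sum_const_mul {ι : Type} [Fintype ι] {F : ι → Base N → ℝ} {p : Base N}
    (hF : ∀ i, ContDiffAt ℝ ∞ (F i) p) (c : ι → ℝ) (v w : Base N) :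
    fderiv ℝ (fun r => fderiv ℝ (fun q => ∑ i, c i * F i q) r v) p w =
      ∑ i, c i * fderiv ℝ (fun r => fderiv ℝ (F i) r v) p w := by
  have h : (fun r => fderiv ℝ (fun q => ∑ i, c i * F i q) r v) =ᶠ[nhds p]
      fun r => ∑ i, c i * fderiv ℝ (F i) r v := by
    filter_upwards [Filter.eventually_all.2 fun i => eventually_differentiableAt (hF i)] with r hr
    rw [fderiv_fun_sum fun i _ => (hr i).const_mul (c i), _root_.sum_apply]
    exact Finset.sum_congr rfl fun i _ => by rw [fderiv_const_mul (hr i)]; rfl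
  rw [h.fderiv_eq, fderiv_sum_const_mul fun i => contDiffAt_fderiv_apply (hF i) v]

lemma laplacian_sum_const_mul {ι : Type} [Fintype ι] {F : ι → Base N → ℝ} {p : Base N}
    (hF : ∀ i, ContDiffAt ℝ ∞ (F i) p) (c : ι → ℝ) (h0 : ∀ i, laplacian A (F i) p = 0) :
    laplacian A (fun q => ∑ i, c i * F i q) p = 0 := by
  have h (v w : Base N) := fderiv_fderiv_sum_const_mul hF c v w
  have h1 (i j : Fin N) : dMu i (dMu j fun q => ∑ i, c i * F i q) p =
    ∑ k, c k * dMu i (dMu j (F k)) p := h _ _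
  have h2 : dReEta (dReEta fun q => ∑ i, c i * F i q) p =
    ∑ k, c k * dReEta (dReEta (F k)) p := h _ _
  have h3 : dImEta (dImEta fun q => ∑ i, c i * F i q) p =
    ∑ k, c k * dImEta (dImEta (F k)) p := h _ _
  have h4 : laplacian A (fun q => ∑ i, c i * F i q) p = ∑ k, c k * laplacian A (F k) p := by
    simp only [laplacian, dEtaEtaBar, h1, h2, h3, mul_add, Finset.sum_add_distrib, Finset.mul_sum]
    congr 1
    · symm
      rw [Finset.sum_comm]
      refine Finset.sum_congr rfl fun i _ => ?_
      rw [Finset.sum_comm]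
      exact Finset.sum_congr rfl fun j _ => Finset.sum_congr rfl fun k _ => by ring
    · congr 1 <;> exact Finset.sum_congr rfl fun k _ => by ring
  rw [h4]
  exact Finset.sum_eq_zero fun k _ => by rw [h0, mul_zero]

end Linearity

/-! ### The first-order ansatz -/

section Ansatz

variable {N : ℕ} {A : Matrix (Fin N) (Fin N) ℝ} {f : Base N → ℝ}

lemma dMu_eq (k : Fin N) (g : Base N → ℝ) (p : Base N) :
    dMu k g p = fderiv ℝ g p (rayVec k.succ) := by rw [rayVec_succ]; rfl

/-- Every `v_{ij}` is a combination of the functions `α_{ib}`. -/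
def ansatzCoeff (i j : Fin N) (b : Fin (N + 1)) : ℝ :=
  if i = j then 1 else if b = j.succ then -1 else 0

lemma ansatzV_eq_sum (hA : A.PosDef) (i j : Fin N) :
    ansatzV A i j = fun p => ∑ b, ansatzCoeff i j b * pairPotential A i.succ b p := by
  by_cases hij : i = j
  · subst hij; simp [ansatzV_self hA, ansatzCoeff]
  · simp [ansatzV_of_ne hA hij, ansatzCoeff, hij]

lemma ansatzW_eq_sum : ansatzW A = fun p => ∑ kl : Fin N × Fin N,
    (A.det * A⁻¹ kl.1 kl.2) * ansatzV A kl.1 kl.2 p := by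
  ext p
  rw [ansatzW, Fintype.sum_prod_type]
  simp only [Finset.mul_sum, mul_assoc]

lemma contDiffAt_sum_const_mul {ι : Type} [Fintype ι] {F : ι → Base N → ℝ} {p : Base N}
    (hF : ∀ i, ContDiffAt ℝ ∞ (F i) p) (c : ι → ℝ) :
    ContDiffAt ℝ ∞ (fun q => ∑ i, c i * F i q) p :=
  ContDiffAt.sum fun i _ => contDiffAt_const.mul (hF i)

lemma locallyIntegrable_sum_const_mul {ι : Type} [Fintype ι] {F : ι → Base N → ℝ}
    (hF : ∀ i, LocallyIntegrable (F i)) (c : ι → ℝ) :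
    LocallyIntegrable (fun q => ∑ i, c i * F i q) :=
  locallyIntegrable_finsetSum _ fun i _ => (hF i).smul (c i)

lemma contDiffAt_ansatzV (hN : 1 ≤ N) (hA : A.PosDef) {p : Base N}
    (hp : ∀ a b, a ≠ b → p ∉ discCone a b) (i j : Fin N) : ContDiffAt ℝ ∞ (ansatzV A i j) p := by
  rw [ansatzV_eq_sum hA]
  exact contDiffAt_sum_const_mul (fun b => contDiffAt_pairPotential hN hA hp _ b) _

lemma contDiffAt_ansatzW (hN : 1 ≤ N) (hA : A.PosDef) {p : Base N}
    (hp : ∀ a b, a ≠ b → p ∉ discCone a b) : ContDiffAt ℝ ∞ (ansatzW A) p := by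
  rw [ansatzW_eq_sum]
  exact contDiffAt_sum_const_mul (fun kl : Fin N × Fin N => contDiffAt_ansatzV hN hA hp kl.1 kl.2) _

lemma locallyIntegrable_ansatzV (hN : 1 ≤ N) (hA : A.PosDef) (i j : Fin N) :
    LocallyIntegrable (ansatzV A i j) := by
  rw [ansatzV_eq_sum hA]
  exact locallyIntegrable_sum_const_mul (fun b => locallyIntegrable_pairPotential hN hA _ b) _

lemma locallyIntegrable_ansatzW (hN : 1 ≤ N) (hA : A.PosDef) :
    LocallyIntegrable (ansatzW A) := by
  rw [ansatzW_eq_sum]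
  exact locallyIntegrable_sum_const_mul
    (fun kl : Fin N × Fin N => locallyIntegrable_ansatzV hN hA kl.1 kl.2) _

lemma laplacian_pairPotential (hN : 1 ≤ N) (hA : A.PosDef) {p : Base N}
    (hp : ∀ a b, a ≠ b → p ∉ discCone a b) (a b : Fin (N + 1)) :
    laplacian A (pairPotential A a b) p = 0 := by
  by_cases hab : a = b
  -- The zero function is the empty combination. Below, a scalar multiple is a combination with one
  -- term.
  · have h := laplacian_sum_const_mul (A := A) (ι := Empty) (F := fun e => e.elim) (p := p)
      (fun e => e.elim) (fun e => e.elim) (fun e => e.elim)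
    rw [hab, pairPotential_self]
    simpa using h
  · have h := laplacian_sum_const_mul (A := A) (ι := Unit) (F := fun _ => facePotential A {a, b})
      (p := p) (fun _ => (isSource_pair hN hab).contDiffAt (isHomKernel_newtonKernel hA) le_rfl
        (hp a b hab)) (fun _ => kernelConst A)
      (fun _ => laplacian_facePotential hN hA hab (hp a b hab))
    rw [pairPotential_of_ne hab]
    simpa using h

lemma laplacian_ansatzV (hN : 1 ≤ N) (hA : A.PosDef) {p : Base N}
    (hp : ∀ a b, a ≠ b → p ∉ discCone a b) (i j : Fin N) : laplacian A (ansatzV A i j) p = 0 := by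
  rw [ansatzV_eq_sum hA]
  exact laplacian_sum_const_mul (fun b => contDiffAt_pairPotential hN hA hp _ b) _
    fun b => laplacian_pairPotential hN hA hp _ b

lemma laplacian_ansatzW (hN : 1 ≤ N) (hA : A.PosDef) {p : Base N}
    (hp : ∀ a b, a ≠ b → p ∉ discCone a b) : laplacian A (ansatzW A) p = 0 := by
  rw [ansatzW_eq_sum]
  exact laplacian_sum_const_mul (fun kl : Fin N × Fin N => contDiffAt_ansatzV hN hA hp kl.1 kl.2) _
    fun kl : Fin N × Fin N => laplacian_ansatzV hN hA hp kl.1 kl.2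

lemma dMu_ansatzV (hN : 1 ≤ N) (hA : A.PosDef) {p : Base N}
    (hp : ∀ a b, a ≠ b → p ∉ discCone a b) (i j k : Fin N) :
    dMu k (ansatzV A i j) p = dMu j (ansatzV A i k) p := by
  have h (i j : Fin N) (v : Base N) := fderiv_sum_const_mul (p := p)
    (fun b => contDiffAt_pairPotential hN hA hp i.succ b) (ansatzCoeff i j) v
  simp only [← ansatzV_eq_sum hA] at h
  refine (commRelations_fderiv hN hA hp).ansatz (V := fun i j k => dMu k (ansatzV A i j) p)
    (fun i k => ?_) (fun i j k hij => ?_) i j k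
  · simp only [dMu_eq, h]
    simp [ansatzCoeff]
  · simp only [dMu_eq, h]
    simp [ansatzCoeff, hij]

lemma integral_ansatzV_mul (hN : 1 ≤ N) (hA : A.PosDef) (hf : IsTestFunction f)
    (i j : Fin N) : ∫ p, ansatzV A i j p * f p =
      ∑ b, ansatzCoeff i j b * ∫ p, pairPotential A i.succ b p * f p := by
  simp only [← integral_const_mul]
  rw [← integral_finsetSum _ fun b _ =>
    (hf.integrable_mul (locallyIntegrable_pairPotential hN hA _ b)).const_mul _]
  simp only [ansatzV_eq_sum hA, Finset.sum_mul, mul_assoc]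

lemma integral_ansatzV_mul_dMu (hN : 1 ≤ N) (hA : A.PosDef) (hf : IsTestFunction f)
    (i j k : Fin N) : ∫ p, ansatzV A i j p * dMu k f p = ∫ p, ansatzV A i k p * dMu j f p := by
  refine (commRelations_integral hN hA hf).ansatz
    (V := fun i j k => ∫ p, ansatzV A i j p * dMu k f p)
    (fun i k => ?_) (fun i j k hij => ?_) i j k
  · rw [integral_ansatzV_mul hN hA (hf.dMu k)]
    simp [ansatzCoeff, dMu_eq]
  · rw [integral_ansatzV_mul hN hA (hf.dMu k)]
    simp [ansatzCoeff, hij, dMu_eq]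

lemma eventually_notMem_discCone {p : Base N} (hp : ∀ a b, a ≠ b → p ∉ discCone a b) :
    ∀ᶠ q in nhds p, ∀ a b, a ≠ b → q ∉ discCone a b := by
  refine Filter.eventually_all.2 fun a => Filter.eventually_all.2 fun b => ?_
  by_cases hab : a = b
  · exact .of_forall fun q h => absurd hab h
  · filter_upwards [(isClosed_discCone a b).isOpen_compl.mem_nhds (hp a b hab)] with q hq _ using hq

/-- The matrix v behaves like a Hessian. The first-order relation exchanges a derivative index with
an index of v, and equality of mixed partials and the symmetry of v supply the remaining
transpositions. -/
lemma dMu_dMu_ansatzV (hN : 1 ≤ N) (hA : A.PosDef) {p : Base N}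
    (hp : ∀ a b, a ≠ b → p ∉ discCone a b) (i j k l : Fin N) :
    dMu i (dMu j (ansatzV A k l)) p = dMu k (dMu l (ansatzV A i j)) p := by
  have hev (i j k : Fin N) : dMu k (ansatzV A i j) =ᶠ[nhds p] dMu j (ansatzV A i k) := by
    filter_upwards [eventually_notMem_discCone hp] with q hq using dMu_ansatzV hN hA hq i j k
  have h1 (m i j k : Fin N) : dMu m (dMu k (ansatzV A i j)) p =
      dMu m (dMu j (ansatzV A i k)) p := by
    simp only [dMu, (hev i j k).fderiv_eq]
  have h2 (i j k l : Fin N) : dMu i (dMu j (ansatzV A k l)) p = dMu j (dMu i (ansatzV A k l)) p :=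
    fderiv_fderiv_comm (contDiffAt_ansatzV hN hA hp k l) _ _
  rw [h1, h2, ansatzV_symm hA, h1, h2, ansatzV_symm hA]

/-- Exchanging the index pairs turns the contraction with A⁻¹ in w into the μ-part of Δ_A v_ij, and
harmonicity expresses this through the η-part. -/
lemma dMu_dMu_ansatzW (hN : 1 ≤ N) (hA : A.PosDef) {p : Base N}
    (hp : ∀ a b, a ≠ b → p ∉ discCone a b) (i j : Fin N) :
    dMu i (dMu j (ansatzW A)) p = -4 * dEtaEtaBar (ansatzV A i j) p := by
  have h := fderiv_fderiv_sum_const_mul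
    (fun kl : Fin N × Fin N => contDiffAt_ansatzV hN hA hp kl.1 kl.2)
    (fun kl => A.det * A⁻¹ kl.1 kl.2) (Pi.single j 1, 0) (Pi.single i 1, 0)
  rw [← ansatzW_eq_sum] at h
  change dMu i (dMu j (ansatzW A)) p = ∑ kl : Fin N × Fin N,
    A.det * A⁻¹ kl.1 kl.2 * dMu i (dMu j (ansatzV A kl.1 kl.2)) p at h
  have h0 := laplacian_ansatzV hN hA hp i j
  have hdet := hA.det_pos.ne'
  rw [h, Fintype.sum_prod_type]
  simp only [dMu_dMu_ansatzV hN hA hp i j, mul_assoc, ← Finset.mul_sum]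
  rw [laplacian] at h0
  rw [eq_neg_of_add_eq_zero_left h0]
  field_simp

lemma integral_ansatzV_mul_dMu_dMu (hN : 1 ≤ N) (hA : A.PosDef) (hf : IsTestFunction f)
    (i j k l : Fin N) : ∫ p, ansatzV A k l p * dMu i (dMu j f) p =
      ∫ p, ansatzV A i j p * dMu k (dMu l f) p := by
  have h1 (m i j k : Fin N) : ∫ p, ansatzV A i j p * dMu k (dMu m f) p =
      ∫ p, ansatzV A i k p * dMu j (dMu m f) p := integral_ansatzV_mul_dMu hN hA (hf.dMu m) i j k
  have h2 (i j : Fin N) : dMu i (dMu j f) = dMu j (dMu i f) := by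
    ext p
    exact fderiv_fderiv_comm hf.1.contDiffAt _ _
  rw [h1, h2, ansatzV_symm hA, h1, h2, ansatzV_symm hA]

/-- The same exchange of index pairs, in the weak sense. No harmonicity is available across the
discriminant locus, so the full Laplacian remains and carries the singular measures. -/
lemma chernPairing_ansatz (hN : 1 ≤ N) (hA : A.PosDef) (hf : IsTestFunction f) (i j : Fin N) :
    chernPairing (ansatzW A) (ansatzV A i j) i j f =
      A.det * ∫ p, ansatzV A i j p * laplacian A f p := by
  have h : ∫ p, ansatzW A p * dMu i (dMu j f) p = A.det * ∑ k, ∑ l, A⁻¹ k l *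
      ∫ p, ansatzV A i j p * dMu k (dMu l f) p := by
    have h1 : ∫ p, ansatzW A p * dMu i (dMu j f) p = ∑ kl : Fin N × Fin N,
        A.det * A⁻¹ kl.1 kl.2 * ∫ p, ansatzV A kl.1 kl.2 p * dMu i (dMu j f) p := by
      simp only [← integral_const_mul]
      rw [← integral_finsetSum _ fun kl _ => (((hf.dMu j).dMu i).integrable_mul
        (locallyIntegrable_ansatzV hN hA kl.1 kl.2)).const_mul _]
      simp only [ansatzW_eq_sum, Finset.sum_mul, mul_assoc]
    rw [h1, Fintype.sum_prod_type]
    simp only [integral_ansatzV_mul_dMu_dMu hN hA hf i j, mul_assoc, ← Finset.mul_sum]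
  have hdet := hA.det_pos.ne'
  rw [chernPairing, h, integral_mul_laplacian (locallyIntegrable_ansatzV hN hA i j) hf]
  field_simp

end Ansatz

/-! ### Currents -/

section Currents

variable {N : ℕ} {A : Matrix (Fin N) (Fin N) ℝ} {f : Base N → ℝ}

lemma wedge3_apply (a b c : Base N →ₗ[ℝ] ℂ) (x : Fin 3 → Base N) :
    wedge3 a b c x = a (x 0) * b (x 1) * c (x 2) - a (x 0) * b (x 2) * c (x 1)
      - a (x 1) * b (x 0) * c (x 2) + a (x 2) * b (x 0) * c (x 1)
      + a (x 1) * b (x 2) * c (x 0) - a (x 2) * b (x 1) * c (x 0) := by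
  have h : wedge3 a b c x = Matrix.det (Matrix.of fun r k => ![a, b, c] k (x r)) := by
    rw [wedge3, MultilinearMap.alternatization_apply, Matrix.det_apply]
    refine Finset.sum_congr rfl fun σ _ => ?_
    simp [MultilinearMap.compLinearMap_apply, MultilinearMap.mkPiAlgebra_apply]
  rw [h, Matrix.det_fin_three]
  simp
  ring

/-- This is dη ∧ dη̄ = -2i dRe η ∧ dIm η, which together with the prefactor i/(4π) gives the real
constant 1/(2π). -/
lemma wedge3_eta (i : Fin N) (x : Fin 3 → Base N) :
    wedge3 (formMu i) formEta formEtaBar x =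
      -2 * Complex.I * wedge3 (formMu i) formRe formIm x := by
  have h1 (p : Base N) : formEta p = formRe p + formIm p * Complex.I := (Complex.re_add_im p.2).symm
  have h2 (p : Base N) : formEtaBar p = formRe p - formIm p * Complex.I := by
    simp only [formEtaBar, formRe, formIm, LinearMap.coe_mk, AddHom.coe_mk]
    exact Complex.ext (by simp) (by simp)
  simp only [wedge3_apply, h1, h2]
  ring

lemma wedge3_sub (i j : Fin N) (x : Fin 3 → Base N) :
    wedge3 (formMu j - formMu i) formRe formIm x =
      wedge3 (formMu j) formRe formIm x - wedge3 (formMu i) formRe formIm x := by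
  simp only [wedge3_apply, LinearMap.sub_apply]
  ring

/-- The mass of `f` on the face `{a, b}`. -/
def faceIntegral (f : Base N → ℝ) (a b : Fin (N + 1)) : ℝ :=
  if a = b then 0 else ∫ u, f (coneMap u) ∂faceMeasure {a, b}

lemma chernPairing_eq (hN : 1 ≤ N) (hA : A.PosDef) (hf : IsTestFunction f) (i j : Fin N) :
    chernPairing (ansatzW A) (ansatzV A i j) i j f =
      -2 * Real.pi * ∑ b, ansatzCoeff i j b * faceIntegral f i.succ b := by
  have hdet := hA.det_pos
  -- All powers of det A cancel, so the resulting currents do not depend on A.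
  have hc : A.det * (√A.det * (volDensity A)⁻¹) = 1 := by
    rw [volDensity, Real.sqrt_eq_rpow, ← Real.rpow_neg hdet.le, ← Real.rpow_add hdet]
    nth_rw 1 [← Real.rpow_one A.det]
    rw [← Real.rpow_add hdet]
    norm_num
  rw [chernPairing_ansatz hN hA hf, integral_ansatzV_mul hN hA hf.laplacian,
    Finset.mul_sum, Finset.mul_sum]
  refine Finset.sum_congr rfl fun b _ => ?_
  by_cases hb : i.succ = b
  · simp [← hb, pairPotential_self, faceIntegral]
  · rw [integral_pairPotential_mul_laplacian hN hA hb hf, faceIntegral, if_neg hb]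
    linear_combination (-2 * Real.pi * ansatzCoeff i j b *
      ∫ u, f (coneMap u) ∂faceMeasure {i.succ, b}) * hc

lemma measure0_eq_faceIntegral (hf : Continuous f) (i : Fin N) :
    measure0 i f = faceIntegral f 0 i.succ := by
  rw [faceIntegral, if_neg (Fin.succ_ne_zero i).symm]
  exact integral_orthant0 i (hf.comp continuous_coneMap).aestronglyMeasurable

lemma measureD_eq_faceIntegral (hf : Continuous f) {i j : Fin N} (hij : i ≠ j) :
    measureD i j f = faceIntegral f i.succ j.succ := by
  rw [faceIntegral, if_neg fun h => hij (Fin.succ_injective _ h)]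
  exact integral_orthant i j (hf.comp continuous_coneMap).aestronglyMeasurable

lemma faceIntegral_symm (a b : Fin (N + 1)) : faceIntegral f a b = faceIntegral f b a := by
  simp only [faceIntegral, Finset.pair_comm a b, eq_comm]

lemma faceIntegral_self (a : Fin (N + 1)) : faceIntegral f a a = 0 := by simp [faceIntegral]

lemma form3_sum_apply {ι : Type} (s : Finset ι) (F : ι → Form3 N) (x : Fin 3 → Base N) :
    (∑ i ∈ s, F i) x = ∑ i ∈ s, F i x := by
  classical
  induction s using Finset.induction_on with
  | empty => simp
  | insert a s ha ih =>
    rw [Finset.sum_insert ha, Finset.sum_insert ha, AlternatingMap.add_apply, ih]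

lemma chernCurrent_apply (v : Fin N → Fin N → Base N → ℝ) (w : Base N → ℝ) (j : Fin N)
    (x : Fin 3 → Base N) : chernCurrent v w f j x =
      (1 / (2 * Real.pi)) * ∑ i, chernPairing w (v i j) i j f *
        wedge3 (formMu i) formRe formIm x := by
  have h (i : Fin N) : (∑ k, tensorE ((chernPairing w (v i k) i k f : ℂ) •
      wedge3 (formMu i) formEta formEtaBar) k) j =
      (chernPairing w (v i j) i j f : ℂ) • wedge3 (formMu i) formEta formEtaBar := by
    simp only [tensorE, Finset.sum_apply, Pi.single_apply]
    simp
  rw [chernCurrent, Pi.smul_apply, Finset.sum_apply, AlternatingMap.smul_apply,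
    Finset.sum_congr rfl fun i _ => h i, form3_sum_apply, smul_eq_mul, Finset.mul_sum,
    Finset.mul_sum]
  refine Finset.sum_congr rfl fun i _ => ?_
  rw [AlternatingMap.smul_apply, wedge3_eta, smul_eq_mul]
  have hpi : (Real.pi : ℂ) ≠ 0 := Complex.ofReal_ne_zero.2 Real.pi_ne_zero
  field_simp
  linear_combination (-4 * chernPairing w (v i j) i j f * wedge3 (formMu i) formRe formIm x : ℂ) *
    Complex.I_sq

/-- The terms D_{ij} ⊗ (e_j - e_i) are invariant under the exchange of i and j, since both factors
change sign. The e_j-component thus collects the pairs on both sides of j into one sum over all i.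
The term i = j vanishes by itself. -/
lemma discriminantCurrent_apply (hf : Continuous f) (j : Fin N) (x : Fin 3 → Base N) :
    discriminantCurrent f j x =
      -(faceIntegral f 0 j.succ * wedge3 (formMu j) formRe formIm x) -
        ∑ i : Fin N, faceIntegral f i.succ j.succ *
          (wedge3 (formMu j) formRe formIm x - wedge3 (formMu i) formRe formIm x) := by
  set W : Fin N → ℂ := fun i => wedge3 (formMu i) formRe formIm x with hW
  have h0 : (∑ i, tensorE (current0 i f) i) j x = -(faceIntegral f 0 j.succ * W j) := by
    simp only [tensorE, Finset.sum_apply, Pi.single_apply, Finset.sum_ite_eq, Finset.mem_univ,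
      if_true, current0, AlternatingMap.smul_apply, measure0_eq_faceIntegral hf, smul_eq_mul]
    ring
  have h1 (i k : Fin N) :
      (if i < k then tensorE (currentD i k f) k - tensorE (currentD i k f) i else 0) j x =
      (if k = j then (if i < j then -(faceIntegral f i.succ j.succ * (W j - W i)) else 0) else 0) +
        if i = j then (if j < k then -(faceIntegral f k.succ j.succ * (W j - W k)) else 0)
          else 0 := by
    by_cases hik : i < k
    · have hD : currentD i k f x = -(faceIntegral f i.succ k.succ * (W k - W i)) := by
        rw [currentD, AlternatingMap.smul_apply, wedge3_sub, measureD_eq_faceIntegral hf hik.ne,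
          smul_eq_mul]
        ring
      rw [if_pos hik, Pi.sub_apply, AlternatingMap.sub_apply]
      by_cases hk : k = j
      · subst hk
        simp [tensorE, hik, hik.ne, hik.ne', hD]
      · by_cases hi : i = j
        · subst hi
          simp [tensorE, hik, hik.ne, hik.ne', hD, faceIntegral_symm k.succ i.succ]
          ring
        · simp [tensorE, hk, hi, Ne.symm hk, Ne.symm hi]
    · rw [if_neg hik]
      by_cases hk : k = j
      · subst hk
        by_cases hi : i = k <;> simp [hik, hi]
      · by_cases hi : i = j
        · subst hi
          simp [hik, hk]
        · simp [hk, hi]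
  rw [discriminantCurrent, Pi.add_apply, AlternatingMap.add_apply, h0, sub_eq_add_neg]
  congr 1
  simp only [Finset.sum_apply, form3_sum_apply]
  simp only [h1, Finset.sum_add_distrib]
  rw [Finset.sum_comm (f := fun i k => if i = j then _ else _)]
  simp only [Finset.sum_ite_eq', Finset.mem_univ, if_true]
  rw [← Finset.sum_add_distrib, ← Finset.sum_neg_distrib]
  refine Finset.sum_congr rfl fun i _ => ?_
  rcases lt_trichotomy i j with h | h | h
  · simp [h, h.not_gt, hW]
  · simp [h]
  · simp [h, h.not_gt, hW]

/-- In the e_j-component the diagonal v_jj contributes all faces through j with dμ_j, and each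
off-diagonal v_ij contributes the face {i, j} with dμ_i and the opposite sign. This is the pattern
dμ_j - dμ_i of the discriminant currents. -/
theorem chernCurrent_ansatz (hN : 1 ≤ N) (hA : A.PosDef) (hf : IsTestFunction f) :
    chernCurrent (ansatzV A) (ansatzW A) f = discriminantCurrent f := by
  funext j
  ext x
  rw [chernCurrent_apply, discriminantCurrent_apply hf.1.continuous]
  simp only [chernPairing_eq hN hA hf]
  set W : Fin N → ℂ := fun i => wedge3 (formMu i) formRe formIm x with hW
  have hpi : (Real.pi : ℂ) ≠ 0 := Complex.ofReal_ne_zero.2 Real.pi_ne_zero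
  have hj : ∑ b, ansatzCoeff j j b * faceIntegral f j.succ b =
      faceIntegral f 0 j.succ + ∑ i : Fin N, faceIntegral f i.succ j.succ := by
    simp only [ansatzCoeff, if_true, one_mul, Fin.sum_univ_succ, faceIntegral_symm j.succ]
  have hi (i : Fin N) (hij : i ≠ j) : ∑ b, ansatzCoeff i j b * faceIntegral f i.succ b =
      -faceIntegral f i.succ j.succ := by
    simp [ansatzCoeff, hij]
  have hsum : ∑ i, ((-2 * Real.pi * ∑ b, ansatzCoeff i j b * faceIntegral f i.succ b : ℝ) : ℂ) *
      W i = ∑ i, (2 * Real.pi * faceIntegral f i.succ j.succ : ℂ) * W i -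
        2 * Real.pi * (faceIntegral f 0 j.succ + ∑ i : Fin N, (faceIntegral f i.succ j.succ : ℂ)) *
          W j := by
    -- The diagonal index is split off on both sides. It can be restored in the sum of off-diagonal
    -- terms because the face integral of the pair (j, j) is 0.
    have he : ∑ i ∈ Finset.univ.erase j,
        ((-2 * Real.pi * ∑ b, ansatzCoeff i j b * faceIntegral f i.succ b : ℝ) : ℂ) * W i =
        ∑ i ∈ Finset.univ.erase j, (2 * Real.pi * faceIntegral f i.succ j.succ : ℂ) * W i :=
      Finset.sum_congr rfl fun i hij => by
        rw [hi i (Finset.ne_of_mem_erase hij)]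
        push_cast
        ring
    rw [← Finset.add_sum_erase _ _ (Finset.mem_univ j), hj, he,
      ← Finset.add_sum_erase _ (fun i => (2 * Real.pi * faceIntegral f i.succ j.succ : ℂ) * W i)
        (Finset.mem_univ j), faceIntegral_self]
    push_cast
    ring
  rw [hsum]
  simp only [mul_sub, Finset.sum_sub_distrib, mul_assoc, ← Finset.mul_sum, ← Finset.sum_mul]
  field_simp
  ring

end Currents

end TaubNUT

end

/-! ### The linearized theorem for the first-order ansatz -/

theorem lemma3p1 (N : ℕ) (hN : 1 ≤ N) (A : Matrix (Fin N) (Fin N) ℝ) (hA : A.PosDef) :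
    -- the integrals converge and define smooth functions away from the discriminant locus
    (∀ i, ∀ p ∈ (discriminant N)ᶜ, IntegrableOn (kernel0 A i p) (orthant0 i)) ∧
    (∀ i j, i < j → ∀ p ∈ (discriminant N)ᶜ, IntegrableOn (kernel A i j p) (orthant i j)) ∧
    (∀ i, ContDiffOn ℝ ∞ (alpha0 A i) (discriminant N)ᶜ) ∧
    (∀ i j, ContDiffOn ℝ ∞ (alpha A i j) (discriminant N)ᶜ) ∧
    -- the distributional Laplace equations
    (∀ i, DistribLaplacianEq A (alpha0 A i)
      (fun f => -2 * Real.pi * √A.det * measure0 i f)) ∧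
    (∀ i j, i < j → DistribLaplacianEq A (alpha A i j)
      (fun f => -2 * Real.pi * √A.det * measureD i j f)) ∧
    -- the commutation relations away from the discriminant locus
    (∀ i j k, i ≠ j → i ≠ k → j ≠ k → ∀ p ∈ (discriminant N)ᶜ,
      dMu k (alpha A i j) p = dMu j (alpha A i k) p) ∧
    (∀ i j, i ≠ j → ∀ p ∈ (discriminant N)ᶜ,
      dMu j (alpha0 A i) p = dMu i (alpha0 A j) p ∧
      dMu i (alpha0 A j) p = -∑ t, dMu t (alpha A i j) p) ∧
    -- the commutation relations in the sense of distributions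
    (∀ i j k, i ≠ j → i ≠ k → j ≠ k → ∀ f, IsTestFunction f →
      ∫ p, alpha A i j p * dMu k f p = ∫ p, alpha A i k p * dMu j f p) ∧
    (∀ i j, i ≠ j → ∀ f, IsTestFunction f →
      ∫ p, alpha0 A i p * dMu j f p = ∫ p, alpha0 A j p * dMu i f p ∧
      ∫ p, alpha0 A j p * dMu i f p = -∑ t, ∫ p, alpha A i j p * dMu t f p) ∧
    -- the first-order ansatz
    (∀ i j, ContDiffOn ℝ ∞ (ansatzV A i j) (discriminant N)ᶜ) ∧
    ContDiffOn ℝ ∞ (ansatzW A) (discriminant N)ᶜ ∧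
    Integrability (ansatzV A) (ansatzW A) (discriminant N)ᶜ ∧
    Harmonicity A (ansatzV A) (ansatzW A) (discriminant N)ᶜ ∧
    ChernCondition (ansatzV A) (ansatzW A) := by
  have hq {p : Base N} (hp : p ∈ (discriminant N)ᶜ) (a b : Fin (N + 1)) (hab : a ≠ b) :
      p ∉ discCone a b := notMem_discCone hp hab
  have hs {i j : Fin N} (hij : i ≠ j) : i.succ ≠ j.succ := fun h => hij (Fin.succ_injective _ h)
  have h0s (i : Fin N) : (0 : Fin (N + 1)) ≠ i.succ := (Fin.succ_ne_zero i).symm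
  refine ⟨fun i p hp => ?_, fun i j hij p hp => ?_, fun i p hp => ?_, fun i j p hp => ?_,
    fun i => ?_, fun i j hij => ?_, fun i j k hij hik hjk p hp => ?_, fun i j hij p hp => ?_,
    fun i j k hij hik hjk f hf => ?_, fun i j hij f hf => ?_, fun i j p hp => ?_, fun p hp => ?_,
    ⟨fun i j k p hp => dMu_ansatzV hN hA (hq hp) i j k,
      fun i j p hp => dMu_dMu_ansatzW hN hA (hq hp) i j⟩,
    ⟨fun i j p hp => laplacian_ansatzV hN hA (hq hp) i j,
      fun p hp => laplacian_ansatzW hN hA (hq hp), fun p _ => rfl⟩,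
    ⟨locallyIntegrable_ansatzV hN hA, locallyIntegrable_ansatzW hN hA,
      fun f hf => chernCurrent_ansatz hN hA hf⟩⟩
  · have h := integrableOn_orthant0 i (g := fun x => newtonKernel A 0 (p - x))
      ((isSource_pair hN (h0s i)).integrable (isHomKernel_newtonKernel hA) le_rfl
        (hq hp _ _ (h0s i)))
    simpa only [← kernel0_eq hA] using h
  · have h := integrableOn_orthant i j (g := fun x => newtonKernel A 0 (p - x))
      ((isSource_pair hN (hs hij.ne)).integrable (isHomKernel_newtonKernel hA) le_rfl
        (hq hp _ _ (hs hij.ne)))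
    simpa only [← kernel_eq hA] using h
  · rw [alpha0_eq hA]
    exact (contDiffAt_pairPotential hN hA (hq hp) _ _).contDiffWithinAt
  · rw [alpha_eq hA]
    exact (contDiffAt_pairPotential hN hA (hq hp) _ _).contDiffWithinAt
  · rw [alpha0_eq hA]
    exact distribLaplacianEq_pairPotential hN hA (h0s i) fun f hf =>
      integral_orthant0 i (hf.comp continuous_coneMap).aestronglyMeasurable
  · rw [alpha_eq hA]
    exact distribLaplacianEq_pairPotential hN hA (hs hij.ne) fun f hf =>
      integral_orthant i j (hf.comp continuous_coneMap).aestronglyMeasurable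
  · simp only [alpha_eq hA, dMu_eq]
    exact (commRelations_fderiv hN hA (hq hp)).comm _ _ _ (hs hij) (hs hik) (hs hjk)
  · have h := commRelations_fderiv hN hA (hq hp)
    simp only [alpha0_eq hA, alpha_eq hA, dMu_eq]
    refine ⟨h.comm _ _ _ (h0s i) (h0s j) (hs hij), ?_⟩
    -- The derivative of α_{0j} along E_i equals that of α_{ij} along E_0 = -∑ E_t.
    rw [h.symm, ← h.zero_eq, h.symm i.succ, h.comm _ _ _ (h0s j).symm (hs hij.symm) (h0s i)]
  · simp only [alpha_eq hA, dMu_eq]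
    exact (commRelations_integral hN hA hf).comm _ _ _ (hs hij) (hs hik) (hs hjk)
  · have h := commRelations_integral hN hA hf
    simp only [alpha0_eq hA, alpha_eq hA, dMu_eq]
    refine ⟨h.comm _ _ _ (h0s i) (h0s j) (hs hij), ?_⟩
    rw [h.symm, ← h.zero_eq, h.symm i.succ, h.comm _ _ _ (h0s j).symm (hs hij.symm) (h0s i)]
  · exact (contDiffAt_ansatzV hN hA (hq hp) i j).contDiffWithinAt
  · exact (contDiffAt_ansatzW hN hA (hq hp)).contDiffWithinAt
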